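/- **Definitions.** Let $G=(V,E)$ be a finite directed graph (without loops and parallel arcs) with $n=|V|$ vertices and $m=|E|$ arcs. For $v\in V$ let $R(v)$ be the set of vertices reachable from $v$ (with $v\in R(v)$), $r(v)=|R(v)|$, and let $d(v,w)$ be the number of arcs of a shortest path from $v$ to $w$. The closeness centrality (Lin's index) of $v$ is $$c(v)=\frac{(r(v)-1)^2}{(n-1)\sum_{w\in R(v)}d(v,w)},$$ and $c(v)=0$ if $v$ has out-degree $0$. The diameter of $G$ is the maximum of $d(v,w)$ over all $v\in V$, $w\in R(v)$. To compute the most closeness-central vertex means: given $G$ by $n$ and the list of its arcs, output some $v\in V$ with $c(v)=\max_{w\in V}c(w)$. Algorithms are deterministic word RAM programs: words have $O(\log s)$ bits, where $s$ is the size of the input ($s=n+m$ for digraphs, $s=N+d$ for $N$ vectors of length $d$), and each elementary operation on words takes one step. The *Orthogonal Vector conjecture* says: there is no $\varepsilon>0$ such that for all constants $k,c$ there is an algorithm which, given $N\ge 2$ vectors in $\{0,1\}^d$ with $d\le c\log^k N$, decides in time $O(N^{2-\varepsilon})$ whether two of them are orthogonal. **Theorem.** If for some $\varepsilon>0$ there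 is an algorithm that computes the most closeness-central vertex of every directed graph with $m\ge 1$ arcs in time $O(m^{2-\varepsilon})$, then the Orthogonal Vector conjecture is false. The same holds even if the input is restricted to sparse graphs: for every integer $K\ge 1$ it suffices that the algorithm works, in time $O(m^{2-\varepsilon})$ for some $\varepsilon>0$, on the directed graphs with $m\ge 1$, $m\le Kn$ and $n\le Km$. It also holds if the input is restricted to those of these sparse graphs whose diameter is at most $9$. -/

import Mathlib

/-! ## Closeness centrality (Lin's index) of directed graphs -/

namespace ClosenessHardness

section Graphs

variable {V : Type*}

/-- `HasWalk G k u v`: there is a directed walk with exactly `k` arcs from `u` to `v` in `G`. -/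
def HasWalk (G : Digraph V) : ℕ → V → V → Prop
  | 0, u, v => u = v
  | k + 1, u, v => ∃ x, G.Adj u x ∧ HasWalk G k x v

/-- `v` is reachable from `u` (every vertex is reachable from itself). -/
def Reaches (G : Digraph V) (u v : V) : Prop := ∃ k, HasWalk G k u v

/-- The number of arcs of a shortest path from `u` to `v`. It is used only when `v` is reachable
from `u` (otherwise it has the junk value `0`). -/
noncomputable def distance (G : Digraph V) (u v : V) : ℕ := sInf {k | HasWalk G k u v}

/-- The number `m` of arcs. -/
noncomputable def arcCount (G : Digraph V) : ℕ := Nat.card {e : V × V // G.Adj e.1 e.2}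

open Classical in
/-- The set of all vertices reachable from `v`, including `v` itself. -/
noncomputable def reachSet [Fintype V] (G : Digraph V) (v : V) : Finset V :=
  Finset.univ.filter (fun w => Reaches G v w)

/-- Closeness centrality (Lin's index): `(r(v) - 1) ^ 2 / ((n - 1) * ∑ d(v, w))`, where `w` ranges
over the `r(v)` vertices reachable from `v`. When `v` reaches only itself this is `0 / 0 = 0`,
which is the convention for vertices of out-degree `0`. -/
noncomputable def closeness [Fintype V] (G : Digraph V) (v : V) : ℚ :=
  (((reachSet G v).card : ℚ) - 1) ^ 2 /
    (((Fintype.card V : ℚ) - 1) * ∑ w ∈ reachSet G v, (distance G v w : ℚ))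

/-- `v` is a vertex of maximum closeness centrality. -/
def IsMostCentral [Fintype V] (G : Digraph V) (v : V) : Prop :=
  ∀ w, closeness G w ≤ closeness G v

/-- The diameter (the maximum distance between two vertices such that the second is reachable
from the first) is at most `D`. -/
def DiameterLE (G : Digraph V) (D : ℕ) : Prop := ∀ u v, Reaches G u v → distance G u v ≤ D

end Graphs

/-! ## The machine model: a word RAM -/

/-- The binary word operations. -/
inductive BinOp
  | add | sub | mul | div | mod | and | or | xor | shl | shr | lt | eq

/-- Semantics of the operations (truncated subtraction; comparisons return `1` or `0`). -/
def BinOp.eval : BinOp → ℕ → ℕ → ℕ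
  | .add, a, b => a + b
  | .sub, a, b => a - b
  | .mul, a, b => a * b
  | .div, a, b => a / b
  | .mod, a, b => a % b
  | .and, a, b => a &&& b
  | .or, a, b => a ||| b
  | .xor, a, b => a ^^^ b
  | .shl, a, b => a <<< b
  | .shr, a, b => a >>> b
  | .lt, a, b => if a < b then 1 else 0
  | .eq, a, b => if a = b then 1 else 0

/-- RAM programs. A program mentions only finitely many registers and finitely many memory arrays
(all named by fixed numbers); array cells are addressed indirectly through registers.
* `const x c`: register `x` gets the constant `c`;
* `op x o y z`: register `x` gets the result of `o` on registers `y` and `z`;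
* `load x a y`: register `x` gets the content of cell (register `y`) of array `a`;
* `store a y x`: cell (register `y`) of array `a` gets the content of register `x`;
* `ite x p q`: run `p` if register `x` is nonzero, otherwise `q`;
* `loop x p`: while register `x` is nonzero, run `p`. -/
inductive Prog
  | skip
  | const (x c : ℕ)
  | op (x : ℕ) (o : BinOp) (y z : ℕ)
  | load (x a y : ℕ)
  | store (a y x : ℕ)
  | seq (p q : Prog)
  | ite (x : ℕ) (p q : Prog)
  | loop (x : ℕ) (p : Prog)

/-- A memory state: contents of the registers and of the cells of the arrays. -/
structure State where
  reg : ℕ → ℕ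
  mem : ℕ → ℕ → ℕ

/-- Write `v` to register `x`. -/
def State.setReg (s : State) (x v : ℕ) : State :=
  { s with reg := Function.update s.reg x v }

/-- Write `v` to cell `i` of array `a`. -/
def State.setMem (s : State) (a i v : ℕ) : State :=
  { s with mem := Function.update s.mem a (Function.update (s.mem a) i v) }

/-- `Run B p s t s'`: started in state `s`, the program `p` halts in state `s'` after exactly `t`
steps, and every word computed on the way is at most `B` (so that words of `log₂ (B + 1)` bits
suffice, also for the addresses). Every instruction and every test takes one step.
There is no such run if a word exceeds `B` or if the program does not halt. -/
inductive Run (B : ℕ) : Prog → State → ℕ → State → Prop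
  | skip (s : State) : Run B .skip s 1 s
  | const (x c : ℕ) (s : State) (h : c ≤ B) : Run B (.const x c) s 1 (s.setReg x c)
  | op (x : ℕ) (o : BinOp) (y z : ℕ) (s : State) (h : o.eval (s.reg y) (s.reg z) ≤ B) :
      Run B (.op x o y z) s 1 (s.setReg x (o.eval (s.reg y) (s.reg z)))
  | load (x a y : ℕ) (s : State) :
      Run B (.load x a y) s 1 (s.setReg x (s.mem a (s.reg y)))
  | store (a y x : ℕ) (s : State) :
      Run B (.store a y x) s 1 (s.setMem a (s.reg y) (s.reg x))
  | seq {p q : Prog} {s₁ s₂ s₃ : State} {t₁ t₂ : ℕ} (h₁ : Run B p s₁ t₁ s₂)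
      (h₂ : Run B q s₂ t₂ s₃) : Run B (.seq p q) s₁ (t₁ + t₂) s₃
  | ite_true {x : ℕ} {p q : Prog} {s s' : State} {t : ℕ} (hx : s.reg x ≠ 0)
      (h : Run B p s t s') : Run B (.ite x p q) s (t + 1) s'
  | ite_false {x : ℕ} {p q : Prog} {s s' : State} {t : ℕ} (hx : s.reg x = 0)
      (h : Run B q s t s') : Run B (.ite x p q) s (t + 1) s'
  | loop_done {x : ℕ} {p : Prog} {s : State} (hx : s.reg x = 0) : Run B (.loop x p) s 1 s
  | loop_step {x : ℕ} {p : Prog} {s₁ s₂ s₃ : State} {t₁ t₂ : ℕ} (hx : s₁.reg x ≠ 0)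
      (h₁ : Run B p s₁ t₁ s₂) (h₂ : Run B (.loop x p) s₂ t₂ s₃) :
      Run B (.loop x p) s₁ (t₁ + t₂ + 1) s₃

/-! ## The two computational problems -/

/-- `arcs` lists every arc of `G` exactly once (in any order). -/
def ListsArcs {V : Type*} (G : Digraph V) (arcs : List (V × V)) : Prop :=
  arcs.Nodup ∧ ∀ u v, (u, v) ∈ arcs ↔ G.Adj u v

/-- The initial state for a digraph on the vertices `0, …, n - 1` with a given list of arcs:
register `0` holds `n`, register `1` holds the number of arcs, and the `i`-th cells of the
arrays `0` and `1` hold tail and head of the `i`-th arc; everything else is `0`. -/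
def graphInput (n : ℕ) (arcs : List (Fin n × Fin n)) : State where
  reg x := if x = 0 then n else if x = 1 then arcs.length else 0
  mem a i :=
    if h : i < arcs.length then
      if a = 0 then ((arcs[i]).1 : ℕ) else if a = 1 then ((arcs[i]).2 : ℕ) else 0
    else 0

/-- Some word RAM program, with words of `O(log (n + m))` bits, finds a most closeness-central
vertex (its number is left in register `0`) of every digraph `G` without loops, with at least one
arc and with the property `𝒢`, in time `O(m ^ (2 - ε))`, where `n` and `m` are the numbers of
vertices and arcs of `G`. -/
def MostCentralSolvable (𝒢 : (n : ℕ) → Digraph (Fin n) → Prop) (ε : ℝ) : Prop :=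
  ∃ (p : Prog) (κ : ℕ) (C : ℝ), ∀ (n : ℕ) (G : Digraph (Fin n)) (arcs : List (Fin n × Fin n)),
    (∀ v, ¬ G.Adj v v) → ListsArcs G arcs → 1 ≤ arcCount G → 𝒢 n G →
      ∃ (t : ℕ) (s : State), Run ((n + arcCount G) ^ κ) p (graphInput n arcs) t s ∧
        (t : ℝ) ≤ C * (arcCount G : ℝ) ^ (2 - ε) ∧
        ∃ v : Fin n, s.reg 0 = (v : ℕ) ∧ IsMostCentral G v

/-- Among the 0-1 vectors `x 0, …, x (N - 1)` of length `d` there are two (at different positions)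
whose inner product is `0`. -/
def HasOrthogonalPair {N d : ℕ} (x : Fin N → Fin d → Bool) : Prop :=
  ∃ i j, i ≠ j ∧ ∑ a, (x i a).toNat * (x j a).toNat = 0

/-- The initial state for `N` vectors of length `d`: register `0` holds `N`, register `1` holds `d`,
and the cell `i * d + j` of the array `0` holds the `j`-th entry of the `i`-th vector; everything
else is `0`. -/
def vectorInput {N d : ℕ} (x : Fin N → Fin d → Bool) : State where
  reg r := if r = 0 then N else if r = 1 then d else 0
  mem a i :=
    if h : i < N * d then
      if a = 0 then (x (Fin.divNat ⟨i, h⟩) (Fin.modNat ⟨i, h⟩)).toNat else 0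
    else 0

/-- Some word RAM program, with words of `O(log (N + d))` bits, decides for all `N ≥ 2` and
`d ≤ c * (log₂ N) ^ k` whether there are two orthogonal vectors among `N` given vectors in
`{0, 1} ^ d` (the answer `1` or `0` is left in register `0`), in time `O(N ^ (2 - ε))`. -/
def OVSolvable (k c : ℕ) (ε : ℝ) : Prop :=
  ∃ (p : Prog) (κ : ℕ) (C : ℝ), ∀ (N d : ℕ) (x : Fin N → Fin d → Bool),
    2 ≤ N → d ≤ c * (Nat.log 2 N) ^ k →
      ∃ (t : ℕ) (s : State), Run ((N + d) ^ κ) p (vectorInput x) t s ∧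
        (t : ℝ) ≤ C * (N : ℝ) ^ (2 - ε) ∧
        (HasOrthogonalPair x → s.reg 0 = 1) ∧ (¬ HasOrthogonalPair x → s.reg 0 = 0)

/-- The Orthogonal Vector conjecture: there is no `ε > 0` such that for every `k` the problem for
`N` vectors of length `d = O(log ^ k N)` can be decided in time `O(N ^ (2 - ε))`. -/
def OrthogonalVectorConjecture : Prop :=
  ∀ ε : ℝ, 0 < ε → ∃ k c : ℕ, ¬ OVSolvable k c ε

end ClosenessHardness

/-!
# Hardness of finding the most closeness-central vertex

Given `N` vectors of length `d`, a program can write down, in time `O(N * (d + 1))`, a digraph in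
which every vertex of maximum closeness is the source of a vector that is orthogonal to some
vector, if there are orthogonal vectors at all. So one call of an algorithm for the most central
vertex, and the comparison of a single vector with all the others, decide whether there are
orthogonal vectors.

In the digraph (`vectorGraph`), the source of the vector `x i` reaches the target of `x j` if and
only if `x i` and `x j` are *not* orthogonal, namely through a coordinate at which both have the
entry `1`. Reaching more vertices usually increases the closeness. To reverse this, every source
also sees four hubs with `L = 4 * (N + d)` leaves each. These leaves make up most of what a source
reaches and have distance `2` from it, so the average distance is about `2`, whereas the path to a
target is stretched to length `5`. In `(r - 1) ^ 2 / S`, the addition of a vertex at more than twice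
the average distance is a loss; hence the closeness of a source strictly decreases with the number
of vectors that are not orthogonal to its vector (`closeness_source_lt`). A hub has only its own
leaves, so its closeness is smaller than that of any source, and all other vertices reach too little
to compete (`closeness_lt_source`). Consequently a vertex of maximum closeness is the source of a
vector with the most orthogonal partners (`exists_source_of_mostCentral`,
`hasOrthogonalPair_iff`).

All arcs lead from one of the levels `0, …, 5` to the next. So distances are differences of levels,
and the diameter is at most `5`. The digraph has no fewer arcs than vertices, and isolated vertices
fill up the difference, which scales all closeness values by the same factor. Hence the number of
vertices equals the number of arcs, and the digraph belongs to the sparse class for every constant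
`K ≥ 1`.

The given program is moved to registers and arrays that do not hold the vectors (`Run.shift`). The
programs before and after it are written with compiled expressions and while loops, whose effect is
described by `Spec`. With `d = O(log ^ k N)` the total time `O((N * (d + 1)) ^ (2 - δ))`, where
`δ = min ε 1`, is `O(N ^ (2 - δ / 2))`.
-/

namespace ClosenessHardness

/-! ### Walks in layered digraphs -/

section Layered

variable {V : Type*} {G : Digraph V}

theorem HasWalk.closed {P : V → Prop} (hP : ∀ u v, G.Adj u v → P u → P v) :
    ∀ {k : ℕ} {u v : V}, HasWalk G k u v → P u → P v
  | 0, _, _, h, hu => by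
    have h : _ = _ := h
    exact h ▸ hu
  | _ + 1, _, _, ⟨_, ha, hw⟩, hu => HasWalk.closed hP hw (hP _ _ ha hu)

theorem HasWalk.level_eq {level : V → ℕ} (hG : ∀ u v, G.Adj u v → level v = level u + 1) :
    ∀ {k : ℕ} {u v : V}, HasWalk G k u v → level v = level u + k
  | 0, _, _, h => by
    have h : _ = _ := h
    rw [h, Nat.add_zero]
  | _ + 1, _, _, ⟨_, ha, hw⟩ => by
    rw [HasWalk.level_eq hG hw, hG _ _ ha]
    omega

theorem Reaches.refl (v : V) : Reaches G v v := ⟨0, rfl⟩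

theorem Reaches.head {u v w : V} (h : G.Adj u v) : Reaches G v w → Reaches G u w
  | ⟨k, hk⟩ => ⟨k + 1, v, h, hk⟩

theorem Reaches.closed {P : V → Prop} (hP : ∀ u v, G.Adj u v → P u → P v) {u v : V}
    (h : Reaches G u v) (hu : P u) : P v :=
  h.elim fun _ hk => hk.closed hP hu

/-- If every arc goes up by one level, then all walks between two vertices have the same length. -/
theorem Reaches.level_eq_add_distance {level : V → ℕ}
    (hG : ∀ u v, G.Adj u v → level v = level u + 1) {u v : V} (h : Reaches G u v) :
    level v = level u + distance G u v :=
  HasWalk.level_eq hG (Nat.sInf_mem (s := {k | HasWalk G k u v}) h)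

theorem Reaches.one_le_distance {u v : V} (h : Reaches G u v) (huv : u ≠ v) :
    1 ≤ distance G u v := by
  have h1 : HasWalk G (distance G u v) u v := Nat.sInf_mem (s := {k | HasWalk G k u v}) h
  by_contra h0
  rw [Nat.lt_one_iff.1 (not_le.1 h0)] at h1
  exact huv h1

variable [Fintype V]

theorem mem_reachSet {u v : V} : v ∈ reachSet G u ↔ Reaches G u v := by
  simp [reachSet]

/-- Every vertex other than `v` that is reachable from `v` has distance at least `1`, so the
closeness is at most the number of these vertices over `n - 1`. -/
theorem closeness_le [Nontrivial V] {v : V} {q : ℕ} (hq : (reachSet G v).card ≤ q + 1) :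
    closeness G v ≤ q / ((Fintype.card V : ℚ) - 1) := by
  classical
  have hv : v ∈ reachSet G v := mem_reachSet.2 (Reaches.refl v)
  have hc : 1 ≤ (reachSet G v).card := Finset.card_pos.2 ⟨v, hv⟩
  have hS : (reachSet G v).card - 1 ≤ ∑ w ∈ reachSet G v, distance G v w := by
    rw [← Finset.card_erase_of_mem hv, Finset.card_eq_sum_ones]
    refine (Finset.sum_le_sum fun w hw => ?_).trans
      (Finset.sum_le_sum_of_subset (Finset.erase_subset v _))
    exact (mem_reachSet.1 (Finset.mem_of_mem_erase hw)).one_le_distance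
      (Finset.ne_of_mem_erase hw).symm
  have hn : (0 : ℚ) < (Fintype.card V : ℚ) - 1 := by
    have : (1 : ℚ) < Fintype.card V := by exact_mod_cast Fintype.one_lt_card
    linarith
  obtain ⟨r, hr⟩ := Nat.exists_eq_add_of_le hc
  rw [hr] at hS hq
  have hS' : (r : ℚ) ≤ ∑ w ∈ reachSet G v, (distance G v w : ℚ) := by
    exact_mod_cast (by omega : r ≤ ∑ w ∈ reachSet G v, distance G v w)
  have hq' : (r : ℚ) ≤ q := by exact_mod_cast (by omega : r ≤ q)
  unfold closeness
  rw [hr, mul_comm, ← div_div, div_le_div_iff_of_pos_right hn]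
  push_cast
  rw [add_sub_cancel_left]
  have hr0 : (0 : ℚ) ≤ r := Nat.cast_nonneg r
  refine div_le_of_le_mul₀ (hr0.trans hS') (hr0.trans hq') ?_
  rw [sq]
  exact mul_le_mul hq' hS' hr0 (hr0.trans hq')

end Layered

section Transport

variable {V W : Type*}

/-- The digraph on `W` obtained by renaming the vertices of `G` along `e`. -/
def relabel (e : V ≃ W) (G : Digraph V) : Digraph W where
  Adj u v := G.Adj (e.symm u) (e.symm v)

theorem hasWalk_relabel (e : V ≃ W) (G : Digraph V) :
    ∀ (k : ℕ) (u v : V), HasWalk (relabel e G) k (e u) (e v) ↔ HasWalk G k u v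
  | 0, u, v => by simp [HasWalk]
  | k + 1, u, v => by
    simp only [HasWalk]
    rw [← e.exists_congr_right]
    refine exists_congr fun a => and_congr ?_ (hasWalk_relabel e G k a v)
    simp only [relabel, Equiv.symm_apply_apply]

theorem closeness_relabel [Fintype V] [Fintype W] (e : V ≃ W) (G : Digraph V) (v : V) :
    closeness (relabel e G) (e v) = closeness G v := by
  have hr : ∀ u w, Reaches (relabel e G) (e u) (e w) ↔ Reaches G u w := fun u w => by
    simp only [Reaches, hasWalk_relabel]
  have hd : ∀ u w, distance (relabel e G) (e u) (e w) = distance G u w := fun u w => by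
    simp only [distance, hasWalk_relabel]
  have hs : reachSet (relabel e G) (e v) = (reachSet G v).map e.toEmbedding := by
    ext w
    obtain ⟨w, rfl⟩ := e.surjective w
    simp [mem_reachSet, hr]
  simp [closeness, hs, hd, Fintype.card_congr e]

end Transport

theorem ListsArcs.arcCount_eq {V : Type*} {G : Digraph V} {arcs : List (V × V)}
    (h : ListsArcs G arcs) : arcCount G = arcs.length := by
  classical
  rw [arcCount, ← List.toFinset_card_of_nodup h.1]
  exact Nat.subtype_card _ fun e => by simp [h.2]

/-! ### The digraph of a family of vectors -/

/-- The vertices of the digraph that encodes `N` vectors of length `d`. The vertices `chain i 0`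
are called sources; they stand for the vectors. -/
inductive Vertex (N d L P : ℕ) : Type
  | chain (i : Fin N) (l : Fin 4)
  | coord (a : Fin d) (c : Fin 3)
  | target (j : Fin N)
  | hub (h : Fin 4)
  | leaf (h : Fin 4) (l : Fin L)
  | pad (q : Fin P)

namespace Vertex

variable {N d L P : ℕ}

/-- Vertices as elements of an iterated sum. -/
def equivSum : Vertex N d L P ≃
    (Fin N × Fin 4) ⊕ (Fin d × Fin 3) ⊕ Fin N ⊕ Fin 4 ⊕ (Fin 4 × Fin L) ⊕ Fin P where
  toFun
    | chain i l => .inl (i, l)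
    | coord a c => .inr (.inl (a, c))
    | target j => .inr (.inr (.inl j))
    | hub h => .inr (.inr (.inr (.inl h)))
    | leaf h l => .inr (.inr (.inr (.inr (.inl (h, l)))))
    | pad q => .inr (.inr (.inr (.inr (.inr q))))
  invFun
    | .inl (i, l) => chain i l
    | .inr (.inl (a, c)) => coord a c
    | .inr (.inr (.inl j)) => target j
    | .inr (.inr (.inr (.inl h))) => hub h
    | .inr (.inr (.inr (.inr (.inl (h, l))))) => leaf h l
    | .inr (.inr (.inr (.inr (.inr q)))) => pad q
  left_inv v := by cases v <;> rfl
  right_inv v := by rcases v with ⟨_, _⟩ | ⟨_, _⟩ | _ | _ | ⟨_, _⟩ | _ <;> rfl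

instance : Fintype (Vertex N d L P) := Fintype.ofEquiv _ equivSum.symm

theorem sum_eq (g : Vertex N d L P → ℕ) :
    ∑ v, g v = ∑ i, ∑ l, g (chain i l) + (∑ a, ∑ c, g (coord a c) + (∑ j, g (target j) +
      (∑ h, g (hub h) + (∑ h, ∑ l, g (leaf h l) + ∑ q, g (pad q))))) := by
  rw [← equivSum.symm.sum_comp]
  simp only [Fintype.sum_sum_type, Fintype.sum_prod_type]
  rfl

/-- The numbering of the vertices: the numbers of the six kinds of vertices form six consecutive
blocks, and pairs are numbered lexicographically. -/
def number : Vertex N d L P ≃ Fin (N * 4 + (d * 3 + (N + (4 + (4 * L + P))))) :=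
  equivSum.trans <|
    (Equiv.sumCongr finProdFinEquiv <| (Equiv.sumCongr finProdFinEquiv <|
      (Equiv.sumCongr (Equiv.refl _) <| (Equiv.sumCongr (Equiv.refl _) <|
        (Equiv.sumCongr finProdFinEquiv (Equiv.refl _)).trans
          finSumFinEquiv).trans finSumFinEquiv).trans finSumFinEquiv).trans
            finSumFinEquiv).trans finSumFinEquiv

theorem number_chain (i : Fin N) (l : Fin 4) :
    (number (chain i l : Vertex N d L P) : ℕ) = 4 * i + l := by
  simp [number, equivSum, add_comm]

theorem number_coord (a : Fin d) (c : Fin 3) :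
    (number (coord a c : Vertex N d L P) : ℕ) = 4 * N + 3 * a + c := by
  simp [number, equivSum]
  ring

theorem number_target (j : Fin N) :
    (number (target j : Vertex N d L P) : ℕ) = 4 * N + 3 * d + j := by
  simp [number, equivSum]
  ring

theorem number_hub (h : Fin 4) :
    (number (hub h : Vertex N d L P) : ℕ) = 5 * N + 3 * d + h := by
  simp [number, equivSum]
  ring

theorem number_leaf (h : Fin 4) (l : Fin L) :
    (number (leaf h l : Vertex N d L P) : ℕ) = 5 * N + 3 * d + 4 + (L * h + l) := by
  simp [number, equivSum]
  ring

/-- The level of a vertex: all arcs go from some level to the next one. -/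
def level : Vertex N d L P → ℕ
  | chain _ l => l
  | coord _ _ => 4
  | target _ => 5
  | hub _ => 1
  | leaf _ _ => 2
  | pad _ => 0

theorem level_le (v : Vertex N d L P) : v.level ≤ 5 := by
  rcases v with ⟨_, l⟩ | _ | _ | _ | _ | _ <;> simp only [level] <;> omega

end Vertex

section

open Vertex

variable {N d L P : ℕ}

/-- The arcs of the digraph that encodes the vectors `x 0, …, x (N - 1)`. The vertex `coord a 1` is
entered from the chains of the vectors with `a`-th entry `1`, and left towards the targets of
these vectors. For the entry `0` the dead end `coord a 0` and the unreachable vertex `coord a 2`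
take over, so that the number of arcs does not depend on the entries. Three hubs would make the
sources more central than the hubs; the fourth one ensures that there are at least as many arcs as
vertices for all `N ≥ 2` and `d`. -/
inductive IsArc (x : Fin N → Fin d → Bool) : Vertex N d L P → Vertex N d L P → Prop
  | step (i : Fin N) (l : Fin 3) : IsArc x (chain i l.castSucc) (chain i l.succ)
  | toHub (i : Fin N) (h : Fin 4) : IsArc x (chain i 0) (hub h)
  | toCoord (i : Fin N) (a : Fin d) : IsArc x (chain i 3) (coord a (bif x i a then 1 else 0))
  | toTarget (j : Fin N) (a : Fin d) : IsArc x (coord a (bif x j a then 1 else 2)) (target j)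
  | toLeaf (h : Fin 4) (l : Fin L) : IsArc x (hub h) (leaf h l)

/-- The digraph that encodes the vectors `x 0, …, x (N - 1)`. -/
def vectorGraph (L P : ℕ) (x : Fin N → Fin d → Bool) : Digraph (Vertex N d L P) where
  Adj := IsArc x

/-- `Meets x i j`: the vectors `x i` and `x j` are not orthogonal. -/
def Meets (x : Fin N → Fin d → Bool) (i j : Fin N) : Prop := ∃ a, x i a = true ∧ x j a = true

instance (x : Fin N → Fin d → Bool) (i j : Fin N) : Decidable (Meets x i j) :=
  inferInstanceAs (Decidable (∃ _, _))

/-- The number of vectors that are not orthogonal to `x i`. -/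
def meetCount (x : Fin N → Fin d → Bool) (i : Fin N) : ℕ :=
  (Finset.univ.filter (Meets x i)).card

theorem meetCount_le (x : Fin N → Fin d → Bool) (i : Fin N) : meetCount x i ≤ N :=
  (Finset.card_le_univ _).trans_eq (Fintype.card_fin N)

variable (x : Fin N → Fin d → Bool)

theorem level_of_adj (u v : Vertex N d L P) (h : (vectorGraph L P x).Adj u v) :
    v.level = u.level + 1 := by
  cases h <;> simp [level]

/-- The vertices that are reachable from the source of the vector `x i`. -/
def ReachedFrom (i : Fin N) : Vertex N d L P → Prop
  | chain i' _ => i' = i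
  | coord a c => c = bif x i a then 1 else 0
  | target j => Meets x i j
  | hub _ => True
  | leaf _ _ => True
  | pad _ => False

instance (i : Fin N) : DecidablePred (ReachedFrom x i : Vertex N d L P → Prop)
  | chain i' _ => inferInstanceAs (Decidable (i' = i))
  | coord _ c => inferInstanceAs (Decidable (c = _))
  | target j => inferInstanceAs (Decidable (Meets x i j))
  | hub _ => inferInstanceAs (Decidable True)
  | leaf _ _ => inferInstanceAs (Decidable True)
  | pad _ => inferInstanceAs (Decidable False)

theorem reaches_source_iff (i : Fin N) (v : Vertex N d L P) :
    Reaches (vectorGraph L P x) (chain i 0) v ↔ ReachedFrom x i v := by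
  constructor
  · intro h
    refine h.closed (P := ReachedFrom x i) ?_ rfl
    intro u v huv hu
    cases huv with
    | step => exact hu
    | toHub => trivial
    | toCoord i' a =>
      have hu : i' = i := hu
      exact hu ▸ rfl
    | toTarget j a =>
      have hu : (bif x j a then (1 : Fin 3) else 2) = bif x i a then 1 else 0 := hu
      refine ⟨a, ?_⟩
      revert hu
      cases x i a <;> cases x j a <;> decide
    | toLeaf => trivial
  · have step (l : Fin 3) {w : Vertex N d L P}
        (h : Reaches (vectorGraph L P x) (chain i l.succ) w) :
        Reaches (vectorGraph L P x) (chain i l.castSucc) w := h.head (IsArc.step i l)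
    have chain_of {w : Vertex N d L P} (h : Reaches (vectorGraph L P x) (chain i 3) w) :
        ∀ l, Reaches (vectorGraph L P x) (chain i l) w
      | 0 => step 0 (step 1 (step 2 h))
      | 1 => step 1 (step 2 h)
      | 2 => step 2 h
      | 3 => h
    have hcoord (a : Fin d) : Reaches (vectorGraph L P x) (chain i 3)
        (coord a (bif x i a then 1 else 0)) := (Reaches.refl _).head (IsArc.toCoord i a)
    intro h
    match v, h with
    | chain _ 0, rfl => exact Reaches.refl _
    | chain _ 1, rfl => exact step 0 (Reaches.refl _)
    | chain _ 2, rfl => exact step 0 (step 1 (Reaches.refl _))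
    | chain _ 3, rfl => exact step 0 (step 1 (step 2 (Reaches.refl _)))
    | coord a _, rfl => exact chain_of (hcoord a) 0
    | target j, ⟨a, hi, hj⟩ =>
      refine chain_of (Reaches.head (IsArc.toCoord i a) (Reaches.head ?_ (Reaches.refl _))) 0
      have := IsArc.toTarget (L := L) (P := P) (x := x) j a
      rw [hj] at this
      rw [hi]
      exact this
    | hub h, _ => exact (Reaches.refl _).head (IsArc.toHub i h)
    | leaf h l, _ => exact ((Reaches.refl _).head (IsArc.toLeaf h l)).head (IsArc.toHub i h)

theorem sum_reachSet_source (i : Fin N) (g : Vertex N d L P → ℕ) :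
    ∑ v ∈ reachSet (vectorGraph L P x) (chain i 0), g v =
      ∑ l, g (chain i l) + (∑ a, g (coord a (bif x i a then 1 else 0)) +
        (∑ j ∈ Finset.univ.filter (Meets x i), g (target j) +
          (∑ h, g (hub h) + ∑ h, ∑ l, g (leaf h l)))) := by
  have h : reachSet (vectorGraph L P x) (chain i 0) = Finset.univ.filter (ReachedFrom x i) := by
    ext v
    simp [mem_reachSet, reaches_source_iff]
  rw [h, Finset.sum_filter, sum_eq]
  change ∑ i', ∑ l, (if i' = i then g (chain i' l) else 0) +
    (∑ a, ∑ c, (if c = bif x i a then 1 else 0 then g (coord a c) else 0) +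
      (∑ j, (if Meets x i j then g (target j) else 0) + (∑ h, g (hub h) +
        (∑ h, ∑ l, g (leaf h l) + ∑ q : Fin P, 0)))) = _
  rw [Finset.sum_comm]
  simp [Finset.sum_filter]

theorem card_reachSet_source (i : Fin N) :
    (reachSet (vectorGraph L P x) (chain i 0)).card = 8 + d + meetCount x i + 4 * L := by
  rw [Finset.card_eq_sum_ones, sum_reachSet_source]
  simp [meetCount]
  ring

theorem sum_distance_source (i : Fin N) :
    ∑ w ∈ reachSet (vectorGraph L P x) (chain i 0), distance (vectorGraph L P x) (chain i 0) w =
      10 + 4 * d + 5 * meetCount x i + 8 * L := by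
  have hd : ∀ w ∈ reachSet (vectorGraph L P x) (chain i 0),
      distance (vectorGraph L P x) (chain i 0) w = w.level := fun w hw => by
    have := (mem_reachSet.1 hw).level_eq_add_distance (level_of_adj x)
    simpa [level] using this.symm
  rw [Finset.sum_congr rfl hd, sum_reachSet_source]
  simp [level, Fin.sum_univ_four, meetCount]
  ring

/-- A vertex other than a source reaches either (part of) one hub and its leaves, or part of one
chain, the coordinates and the targets, or nothing but itself. -/
theorem card_reachSet_le (hL : 3 + 3 * d + N ≤ L) (v : Vertex N d L P)
    (hv : ∀ i, v ≠ chain i 0) : (reachSet (vectorGraph L P x) v).card ≤ L + 1 := by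
  classical
  have key (S : Finset (Vertex N d L P)) (hS : v ∈ S)
      (hc : ∀ u w, IsArc x u w → u ∈ S → w ∈ S) (hcard : S.card ≤ L + 1) :
      (reachSet (vectorGraph L P x) v).card ≤ L + 1 :=
    (Finset.card_le_card fun w hw => (mem_reachSet.1 hw).closed hc hS).trans hcard
  have chains (s : Finset (Fin N)) (hs : s.card ≤ 1)
      (hv : v ∈ ((s ×ˢ {1, 2, 3}).image fun p => chain p.1 p.2) ∪
        ((Finset.univ.image fun p : Fin d × Fin 3 => coord p.1 p.2) ∪
          Finset.univ.image target)) :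
      (reachSet (vectorGraph L P x) v).card ≤ L + 1 := by
    refine key _ hv ?_ ?_
    · intro u w huw hu
      cases huw with
      | step i l =>
        fin_cases l <;> simp_all
      | _ => simp_all
    · refine (Finset.card_union_le _ _).trans ?_
      have h1 := Finset.card_image_le (s := s ×ˢ ({1, 2, 3} : Finset (Fin 4)))
        (f := fun p => (chain p.1 p.2 : Vertex N d L P))
      have h2 := Finset.card_union_le
        (Finset.univ.image fun p : Fin d × Fin 3 => (coord p.1 p.2 : Vertex N d L P))
        (Finset.univ.image target)
      have h3 := Finset.card_image_le (s := Finset.univ)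
        (f := fun p : Fin d × Fin 3 => (coord p.1 p.2 : Vertex N d L P))
      have h4 := Finset.card_image_le (s := Finset.univ)
        (f := (target : _ → Vertex N d L P))
      rw [Finset.card_product] at h1
      simp at h1 h3 h4
      omega
  have hubs (h : Fin 4) (hv : v ∈ insert (hub h) (Finset.univ.image (leaf h))) :
      (reachSet (vectorGraph L P x) v).card ≤ L + 1 := by
    refine key _ hv ?_ ?_
    · intro u w huw hu
      cases huw <;> simp_all
    · refine (Finset.card_insert_le _ _).trans (Nat.succ_le_succ ?_)
      exact Finset.card_image_le.trans_eq (by simp)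
  cases v with
  | chain i l =>
    have hl : l ≠ 0 := fun h => hv i (h ▸ rfl)
    refine chains {i} (by simp) ?_
    fin_cases l <;> simp_all
  | coord => exact chains ∅ (by simp) (by simp)
  | target => exact chains ∅ (by simp) (by simp)
  | hub h => exact hubs h (by simp)
  | leaf h => exact hubs h (by simp)
  | pad q =>
    refine key {pad q} (by simp) ?_ (by simp)
    intro u w huw hu
    cases huw <;> simp_all

/-- The number of leaves at each hub: enough for the leaves to outweigh everything else. -/
def leafCount (N d : ℕ) : ℕ := 4 * (N + d)

theorem closeness_source (i : Fin N) :
    closeness (vectorGraph L P x) (chain i 0) =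
      (7 + d + meetCount x i + 4 * L : ℚ) ^ 2 / (10 + 4 * d + 5 * meetCount x i + 8 * L) /
        ((Fintype.card (Vertex N d L P) : ℚ) - 1) := by
  rw [closeness, ← Nat.cast_sum, sum_distance_source, card_reachSet_source, div_div]
  push_cast
  congr 1
  · ring
  · ring

/-- Leaves have distance `2` from a source, and the targets have distance `5`, which is more than
twice the average distance. So the closeness of a source decreases with the number of targets
that it reaches. -/
theorem closeness_source_lt [Nontrivial (Vertex N d (leafCount N d) P)] {i j : Fin N}
    (h : meetCount x i < meetCount x j) :
    closeness (vectorGraph (leafCount N d) P x) (chain j 0) <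
      closeness (vectorGraph (leafCount N d) P x) (chain i 0) := by
  have hn : (0 : ℚ) < (Fintype.card (Vertex N d (leafCount N d) P) : ℚ) - 1 := by
    rw [sub_pos]
    exact_mod_cast Fintype.one_lt_card
  rw [closeness_source, closeness_source, div_lt_div_iff_of_pos_right hn,
    div_lt_div_iff₀ (by positivity) (by positivity)]
  have hj := meetCount_le x j
  generalize meetCount x i = p at *
  generalize meetCount x j = q at *
  have hL : (leafCount N d : ℚ) = 4 * N + 4 * d := by simp [leafCount]; ring
  obtain ⟨r, rfl⟩ := Nat.exists_eq_add_of_lt h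
  obtain ⟨s, rfl⟩ := Nat.exists_eq_add_of_le hj
  rw [hL]
  push_cast
  have hd : (0 : ℚ) ≤ d := Nat.cast_nonneg d
  have hp : (0 : ℚ) ≤ p := Nat.cast_nonneg p
  have hr : (0 : ℚ) ≤ r := Nat.cast_nonneg r
  have hs : (0 : ℚ) ≤ s := Nat.cast_nonneg s
  rw [← sub_pos]
  ring_nf
  positivity

/-- A vertex other than a source reaches at most `L` other vertices, so that `(r - 1) ^ 2 / S ≤ L`,
whereas this ratio is about `(4 * L) ^ 2 / (8 * L) = 2 * L` for a source. -/
theorem closeness_lt_source [Nontrivial (Vertex N d (leafCount N d) P)] (hN : 2 ≤ N)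
    {v : Vertex N d (leafCount N d) P} (hv : ∀ i, v ≠ chain i 0) (i : Fin N) :
    closeness (vectorGraph (leafCount N d) P x) v <
      closeness (vectorGraph (leafCount N d) P x) (chain i 0) := by
  have hn : (0 : ℚ) < (Fintype.card (Vertex N d (leafCount N d) P) : ℚ) - 1 := by
    rw [sub_pos]
    exact_mod_cast Fintype.one_lt_card
  refine (closeness_le (card_reachSet_le x (by unfold leafCount; omega) v hv)).trans_lt ?_
  rw [closeness_source, div_lt_div_iff_of_pos_right hn, lt_div_iff₀ (by positivity)]
  have hq : (0 : ℚ) ≤ meetCount x i := Nat.cast_nonneg _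
  have hd : (0 : ℚ) ≤ d := Nat.cast_nonneg _
  have hl : (0 : ℚ) ≤ leafCount N d := Nat.cast_nonneg _
  generalize (leafCount N d : ℚ) = l, (meetCount x i : ℚ) = q, (d : ℚ) = d at *
  rw [← sub_pos]
  ring_nf
  positivity

theorem exists_source_of_mostCentral (hN : 2 ≤ N) {v : Vertex N d (leafCount N d) P}
    (hv : IsMostCentral (vectorGraph (leafCount N d) P x) v) :
    ∃ i, v = chain i 0 ∧ ∀ j, meetCount x i ≤ meetCount x j := by
  have : Nontrivial (Vertex N d (leafCount N d) P) :=
    ⟨hub 0, hub 1, fun h => by cases h⟩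
  by_contra! h
  by_cases hs : ∃ i, v = chain i 0
  · obtain ⟨i, rfl⟩ := hs
    obtain ⟨j, hj⟩ := h i rfl
    exact (hv (chain j 0)).not_gt (closeness_source_lt x hj)
  · push Not at hs
    exact (hv (chain ⟨0, by omega⟩ 0)).not_gt (closeness_lt_source x hN hs _)

theorem not_meets_iff (i j : Fin N) :
    ¬ Meets x i j ↔ ∑ a, (x i a).toNat * (x j a).toNat = 0 := by
  simp only [Finset.sum_eq_zero_iff, Meets, Finset.mem_univ, true_implies, not_exists]
  refine forall_congr' fun a => ?_
  cases x i a <;> cases x j a <;> simp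

/-- Some two vectors are orthogonal if and only if a vector with the fewest non-orthogonal partners
is orthogonal to some vector (possibly to itself, in which case it is the zero vector). -/
theorem hasOrthogonalPair_iff (hN : 2 ≤ N) {i : Fin N}
    (hi : ∀ j, meetCount x i ≤ meetCount x j) :
    HasOrthogonalPair x ↔ ∃ j, ∑ a, (x i a).toNat * (x j a).toNat = 0 := by
  simp only [HasOrthogonalPair, ← not_meets_iff]
  constructor
  · rintro ⟨k, l, -, hkl⟩
    by_contra! h
    have h1 : meetCount x i = N := by
      rw [meetCount, Finset.filter_true_of_mem fun j _ => h j, Finset.card_univ,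
        Fintype.card_fin]
    have h2 : meetCount x k < (Finset.univ : Finset (Fin N)).card :=
      Finset.card_lt_card (Finset.filter_ssubset.2 ⟨l, Finset.mem_univ l, hkl⟩)
    rw [Finset.card_univ, Fintype.card_fin] at h2
    have := hi k
    omega
  · rintro ⟨j, hj⟩
    by_cases hij : i = j
    · subst hij
      have : Nontrivial (Fin N) := Fin.nontrivial_iff_two_le.2 hN
      obtain ⟨l, hl⟩ := exists_ne i
      exact ⟨i, l, hl.symm, fun ⟨a, ha, _⟩ => hj ⟨a, ha, ha⟩⟩
    · exact ⟨i, j, hij, hj⟩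

end

/-! ### Relocation of programs -/

section

theorem Run.mono {B B' : ℕ} (hB : B ≤ B') {p : Prog} {s s' : State} {t : ℕ}
    (h : Run B p s t s') : Run B' p s t s' := by
  induction h with
  | skip s => exact .skip s
  | const x c s h => exact .const x c s (h.trans hB)
  | op x o y z s h => exact .op x o y z s (h.trans hB)
  | load x a y s => exact .load x a y s
  | store a y x s => exact .store a y x s
  | seq _ _ ih₁ ih₂ => exact .seq ih₁ ih₂
  | ite_true hx _ ih => exact .ite_true hx ih
  | ite_false hx _ ih => exact .ite_false hx ih
  | loop_done hx => exact .loop_done hx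
  | loop_step hx _ _ ih₁ ih₂ => exact .loop_step hx ih₁ ih₂

/-- The same program on the registers from `16` on and the arrays from `1` on. -/
def Prog.shift : Prog → Prog
  | skip => skip
  | const x c => const (x + 16) c
  | op x o y z => op (x + 16) o (y + 16) (z + 16)
  | load x a y => load (x + 16) (a + 1) (y + 16)
  | store a y x => store (a + 1) (y + 16) (x + 16)
  | seq p q => seq p.shift q.shift
  | ite x p q => ite (x + 16) p.shift q.shift
  | loop x p => loop (x + 16) p.shift

/-- `Hosts u s`: the state `u` contains a relocated copy of the state `s`. -/
structure Hosts (u s : State) : Prop where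
  reg : ∀ r, u.reg (r + 16) = s.reg r
  mem : ∀ a, u.mem (a + 1) = s.mem a

theorem Hosts.setReg {u s : State} (h : Hosts u s) (x v : ℕ) :
    Hosts (u.setReg (x + 16) v) (s.setReg x v) where
  reg r := by simp [State.setReg, Function.update_apply, h.reg]
  mem := h.mem

theorem Hosts.setMem {u s : State} (h : Hosts u s) (a i v : ℕ) :
    Hosts (u.setMem (a + 1) i v) (s.setMem a i v) where
  reg := h.reg
  mem b := by
    by_cases hb : b = a <;> simp [State.setMem, h.mem, hb]

/-- The part of the memory that a relocated program leaves alone is equal in both states. -/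
structure SameLow (u u' : State) : Prop where
  reg : ∀ r < 16, u'.reg r = u.reg r
  mem : u'.mem 0 = u.mem 0

theorem SameLow.refl (u : State) : SameLow u u := ⟨fun _ _ => rfl, rfl⟩

theorem SameLow.trans {u v w : State} (h : SameLow u v) (h' : SameLow v w) : SameLow u w :=
  ⟨fun r hr => (h'.reg r hr).trans (h.reg r hr), h'.mem.trans h.mem⟩

theorem SameLow.setReg (u : State) (x v : ℕ) : SameLow u (u.setReg (x + 16) v) :=
  ⟨fun r hr => Function.update_of_ne (by omega) _ _, rfl⟩

theorem Run.shift {B : ℕ} {p : Prog} {s s' : State} {t : ℕ} (h : Run B p s t s') :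
    ∀ u, Hosts u s → ∃ u', Run B p.shift u t u' ∧ Hosts u' s' ∧ SameLow u u' := by
  induction h with
  | skip s => exact fun u hu => ⟨u, .skip u, hu, .refl u⟩
  | const x c s h => exact fun u hu => ⟨_, .const _ _ _ h, hu.setReg x c, .setReg u x c⟩
  | op x o y z s h =>
    intro u hu
    rw [← hu.reg, ← hu.reg] at h ⊢
    exact ⟨_, .op _ _ _ _ _ h, hu.setReg _ _, .setReg _ _ _⟩
  | load x a y s =>
    intro u hu
    rw [← hu.reg, ← hu.mem]
    exact ⟨_, .load _ _ _ _, hu.setReg _ _, .setReg _ _ _⟩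
  | store a y x s =>
    intro u hu
    rw [← hu.reg, ← hu.reg]
    exact ⟨_, .store _ _ _ _, hu.setMem _ _ _, fun _ _ => rfl,
      by simp [State.setMem]⟩
  | seq _ _ ih₁ ih₂ =>
    intro u hu
    obtain ⟨v, h1, h2, h3⟩ := ih₁ u hu
    obtain ⟨w, h4, h5, h6⟩ := ih₂ v h2
    exact ⟨w, .seq h1 h4, h5, h3.trans h6⟩
  | ite_true hx _ ih =>
    intro u hu
    obtain ⟨v, h1, h2, h3⟩ := ih u hu
    exact ⟨v, .ite_true (by rwa [hu.reg]) h1, h2, h3⟩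
  | ite_false hx _ ih =>
    intro u hu
    obtain ⟨v, h1, h2, h3⟩ := ih u hu
    exact ⟨v, .ite_false (by rwa [hu.reg]) h1, h2, h3⟩
  | loop_done hx => exact fun u hu => ⟨u, .loop_done (by rwa [hu.reg]), hu, .refl u⟩
  | loop_step hx _ _ ih₁ ih₂ =>
    intro u hu
    obtain ⟨v, h1, h2, h3⟩ := ih₁ u hu
    obtain ⟨w, h4, h5, h6⟩ := ih₂ v h2
    exact ⟨w, .loop_step (by rwa [hu.reg]) h1 h4, h5, h3.trans h6⟩

/-! ### Expressions and structured programs -/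

/-- Arithmetic expressions in the registers `0, …, 7` and the array cells. -/
inductive Expr
  | var (r : Fin 8)
  | const (c : ℕ)
  | bin (o : BinOp) (e f : Expr)
  | load (a : ℕ) (e : Expr)

namespace Expr

/-- The value of an expression. -/
def eval (s : State) : Expr → ℕ
  | var r => s.reg r
  | const c => c
  | bin o e f => o.eval (e.eval s) (f.eval s)
  | load a e => s.mem a (e.eval s)

/-- No intermediate result of the evaluation exceeds the word bound. -/
def Fits (B : ℕ) (s : State) : Expr → Prop
  | var r => s.reg r ≤ B
  | const c => c ≤ B
  | bin o e f => e.Fits B s ∧ f.Fits B s ∧ o.eval (e.eval s) (f.eval s) ≤ B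
  | load _ e => e.Fits B s

/-- The number of registers needed for the evaluation. -/
def depth : Expr → ℕ
  | var _ => 1
  | const _ => 1
  | bin _ e f => max e.depth (f.depth + 1)
  | load _ e => e.depth

/-- The number of steps of the evaluation. -/
def cost : Expr → ℕ
  | var _ => 1
  | const _ => 1
  | bin _ e f => e.cost + (f.cost + 1)
  | load _ e => e.cost + 1

/-- A program that leaves the value of the expression in register `x`, with the registers above
`x` as scratch space. -/
def compile : Expr → ℕ → Prog
  | var r, x => .op x .or r r
  | const c, x => .const x c
  | bin o e f, x => .seq (e.compile x) (.seq (f.compile (x + 1)) (.op x o x (x + 1)))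
  | load a e, x => .seq (e.compile x) (.load x a x)

end Expr

/-- Two states agree up to the scratch registers `8, …, 15`. -/
structure Agree (s s' : State) : Prop where
  mem : s.mem = s'.mem
  reg : ∀ r, r < 8 ∨ 16 ≤ r → s.reg r = s'.reg r

theorem Agree.refl (s : State) : Agree s s := ⟨rfl, fun _ _ => rfl⟩

theorem Agree.trans {s t u : State} (h : Agree s t) (h' : Agree t u) : Agree s u :=
  ⟨h.mem.trans h'.mem, fun r hr => (h.reg r hr).trans (h'.reg r hr)⟩

theorem Agree.setReg {s s' : State} (h : Agree s s') (x v : ℕ) :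
    Agree (s.setReg x v) (s'.setReg x v) := by
  refine ⟨h.mem, fun r hr => ?_⟩
  by_cases hrx : r = x <;> simp [State.setReg, hrx, h.reg r hr]

theorem Agree.setMem {s s' : State} (h : Agree s s') (a i v : ℕ) :
    Agree (s.setMem a i v) (s'.setMem a i v) :=
  ⟨by simp [State.setMem, h.mem], h.reg⟩

theorem Expr.eval_congr {s s' : State} (hm : s.mem = s'.mem) (hr : ∀ r < 8, s.reg r = s'.reg r) :
    ∀ e : Expr, e.eval s = e.eval s'
  | var r => hr r r.2
  | const _ => rfl
  | bin _ e f => by simp only [eval, eval_congr hm hr e, eval_congr hm hr f]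
  | load _ e => by simp only [eval, eval_congr hm hr e, hm]

theorem Expr.fits_congr {B : ℕ} {s s' : State} (hm : s.mem = s'.mem)
    (hr : ∀ r < 8, s.reg r = s'.reg r) : ∀ e : Expr, e.Fits B s ↔ e.Fits B s'
  | var r => by simp only [Fits, hr r r.2]
  | const _ => Iff.rfl
  | bin _ e f => by
    simp only [Fits, fits_congr hm hr e, fits_congr hm hr f, eval_congr hm hr e,
      eval_congr hm hr f]
  | load _ e => by simp only [Fits, fits_congr hm hr e]

theorem Expr.run_compile {B : ℕ} : ∀ (e : Expr) {x : ℕ} {s : State}, 8 ≤ x → x + e.depth ≤ 16 →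
    e.Fits B s → ∃ s', Run B (e.compile x) s e.cost s' ∧ s'.reg x = e.eval s ∧ s'.mem = s.mem ∧
      ∀ r, r < x ∨ 16 ≤ r → s'.reg r = s.reg r
  | var r, x, s, hx, hd, hf => by
    have hd : x + 1 ≤ 16 := hd
    have h : BinOp.or.eval (s.reg r) (s.reg r) = s.reg r := Nat.or_self _
    refine ⟨_, .op x .or r r s (h.trans_le hf), ?_, rfl, fun y hy => ?_⟩
    · simp [State.setReg, h, eval]
    · exact Function.update_of_ne (by omega) _ _
  | const c, x, s, hx, hd, hf => by
    have hd : x + 1 ≤ 16 := hd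
    exact ⟨_, .const x c s hf, by simp [State.setReg, eval], rfl,
      fun y hy => Function.update_of_ne (by omega) _ _⟩
  | bin o e f, x, s, hx, hd, hf => by
    have hd : x + max e.depth (f.depth + 1) ≤ 16 := hd
    obtain ⟨hf1, hf2, hf3⟩ := hf
    obtain ⟨s₁, h1, h2, h3, h4⟩ := run_compile e (x := x) hx (by omega) hf1
    have hr : ∀ r < 8, s₁.reg r = s.reg r := fun r hr => h4 r (by omega)
    obtain ⟨s₂, h5, h6, h7, h8⟩ := run_compile f (x := x + 1) (s := s₁) (by omega) (by omega)
      ((fits_congr h3 hr f).2 hf2)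
    have h9 : s₂.reg x = e.eval s := (h8 x (by omega)).trans h2
    have h10 : s₂.reg (x + 1) = f.eval s := h6.trans (eval_congr h3 hr f)
    refine ⟨_, .seq h1 (.seq h5 (.op x o x (x + 1) s₂ ?_)), ?_, h7.trans h3, fun y hy => ?_⟩
    · rwa [h9, h10]
    · simp [State.setReg, eval, h9, h10]
    · exact (Function.update_of_ne (by omega) _ _).trans ((h8 y (by omega)).trans (h4 y hy))
  | load a e, x, s, hx, hd, hf => by
    obtain ⟨s₁, h1, h2, h3, h4⟩ := run_compile e (x := x) hx hd hf
    have hd : 1 ≤ e.depth := by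
      clear * -
      induction e <;> simp_all [depth]
    have hd' : x + e.depth ≤ 16 := ‹_›
    refine ⟨_, .seq h1 (.load x a x s₁), ?_, h3, fun y hy => ?_⟩
    · simp [State.setReg, eval, h2, h3]
    · exact (Function.update_of_ne (by omega) _ _).trans (h4 y hy)

/-- `Spec B p s T s'`: up to scratch registers, the program `p` leads from the state `s` to the
state `s'` in at most `T` steps, with words bounded by `B`. -/
def Spec (B : ℕ) (p : Prog) (s : State) (T : ℕ) (s' : State) : Prop :=
  ∀ u, Agree u s → ∃ t ≤ T, ∃ u', Run B p u t u' ∧ Agree u' s'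

variable {B : ℕ}

theorem Spec.seq {p q : Prog} {s₁ s₂ s₃ : State} {T₁ T₂ : ℕ} (h₁ : Spec B p s₁ T₁ s₂)
    (h₂ : Spec B q s₂ T₂ s₃) : Spec B (.seq p q) s₁ (T₁ + T₂) s₃ := by
  intro u hu
  obtain ⟨t, ht, v, hv, hv'⟩ := h₁ u hu
  obtain ⟨t', ht', w, hw, hw'⟩ := h₂ v hv'
  exact ⟨_, Nat.add_le_add ht ht', w, .seq hv hw, hw'⟩

theorem Spec.mono {p : Prog} {s s' : State} {T T' : ℕ} (h : Spec B p s T s') (hT : T ≤ T') :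
    Spec B p s T' s' := fun u hu =>
  let ⟨t, ht, h⟩ := h u hu
  ⟨t, ht.trans hT, h⟩

/-- Copy register `y` to register `x`. -/
def Prog.copy (x y : ℕ) : Prog := .op x .or y y

theorem Spec.copy {s : State} {x y : ℕ} (hy : y < 8 ∨ 16 ≤ y) (hB : s.reg y ≤ B) :
    Spec B (.copy x y) s 1 (s.setReg x (s.reg y)) := by
  intro u hu
  have h : BinOp.or.eval (u.reg y) (u.reg y) = s.reg y := (Nat.or_self _).trans (hu.reg y hy)
  refine ⟨1, le_rfl, _, .op x .or y y u (h.trans_le hB), ?_⟩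
  rw [h]
  exact hu.setReg _ _

/-- Put the value of `e` into register `x`. -/
def Prog.assign (x : ℕ) (e : Expr) : Prog := .seq (e.compile 8) (.copy x 8)

/-- An expression compiled to register `8` changes nothing but scratch registers. -/
theorem Expr.spec_compile {e : Expr} {s u : State} (hd : e.depth ≤ 8) (hf : e.Fits B s)
    (hu : Agree u s) :
    ∃ u', Run B (e.compile 8) u e.cost u' ∧ u'.reg 8 = e.eval s ∧ Agree u' s := by
  have hr : ∀ r < 8, u.reg r = s.reg r := fun r hr => hu.reg r (.inl hr)
  obtain ⟨u', h1, h2, h3, h4⟩ := e.run_compile le_rfl (by omega) ((fits_congr hu.mem hr e).2 hf)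
  exact ⟨u', h1, h2.trans (eval_congr hu.mem hr e), h3.trans hu.mem,
    fun r hr => (h4 r hr).trans (hu.reg r hr)⟩

theorem Spec.assign {s : State} {x : ℕ} {e : Expr} (hd : e.depth ≤ 8) (hf : e.Fits B s)
    (hB : e.eval s ≤ B) : Spec B (.assign x e) s (e.cost + 1) (s.setReg x (e.eval s)) := by
  intro u hu
  obtain ⟨v, h1, h2, h3⟩ := e.spec_compile hd hf hu
  have h : BinOp.or.eval (v.reg 8) (v.reg 8) = e.eval s := (Nat.or_self _).trans h2
  refine ⟨_, le_rfl, _, .seq h1 (.op x .or 8 8 v (h.trans_le hB)), ?_⟩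
  rw [h]
  exact h3.setReg _ _

/-- Put the value of `f` into the cell of array `a` whose address is the value of `e`. -/
def Prog.write (a : ℕ) (e f : Expr) : Prog :=
  .seq (e.compile 8) (.seq (f.compile 9) (.store a 8 9))

theorem Spec.write {s : State} {a : ℕ} {e f : Expr} (hde : e.depth ≤ 8) (hdf : f.depth ≤ 7)
    (hfe : e.Fits B s) (hff : f.Fits B s) :
    Spec B (.write a e f) s (e.cost + (f.cost + 1)) (s.setMem a (e.eval s) (f.eval s)) := by
  intro u hu
  obtain ⟨v, h1, h2, h3⟩ := e.spec_compile hde hfe hu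
  have hr : ∀ r < 8, v.reg r = s.reg r := fun r hr => h3.reg r (.inl hr)
  obtain ⟨w, h4, h5, h6, h7⟩ := f.run_compile (x := 9) (by omega) (by omega)
    ((Expr.fits_congr h3.mem hr f).2 hff)
  refine ⟨_, le_rfl, _, .seq h1 (.seq h4 (.store a 8 9 w)), ?_⟩
  rw [h7 8 (by omega), h2, h5, Expr.eval_congr h3.mem hr f]
  exact Agree.setMem ⟨h6.trans h3.mem, fun r hr => (h7 r (by omega)).trans (h3.reg r hr)⟩ _ _ _

/-- Run `p` as long as the value of `e` is nonzero. -/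
def Prog.while (e : Expr) (p : Prog) : Prog :=
  .seq (e.compile 8) (.loop 8 (.seq p (e.compile 8)))

theorem Spec.while {e : Expr} {p : Prog} {T M : ℕ} (σ : ℕ → State) (hd : e.depth ≤ 8)
    (hp : ∀ k < M, Spec B p (σ k) T (σ (k + 1))) (hf : ∀ k ≤ M, e.Fits B (σ k))
    (hpos : ∀ k < M, e.eval (σ k) ≠ 0) (hM : e.eval (σ M) = 0) :
    Spec B (.while e p) (σ 0) (e.cost + 1 + M * (T + e.cost + 1)) (σ M) := by
  have key (j : ℕ) : ∀ k, k + j = M → ∀ u, Agree u (σ k) → u.reg 8 = e.eval (σ k) →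
      ∃ t ≤ 1 + j * (T + e.cost + 1), ∃ u',
        Run B (.loop 8 (.seq p (e.compile 8))) u t u' ∧ Agree u' (σ M) := by
    induction j with
    | zero =>
      rintro k rfl u hu h8
      exact ⟨1, by omega, u, .loop_done (h8.trans hM), hu⟩
    | succ j ih =>
      intro k hk u hu h8
      obtain ⟨t, ht, v, hv, hv'⟩ := hp k (by omega) u hu
      obtain ⟨w, h1, h2, h3⟩ := e.spec_compile hd (hf (k + 1) (by omega)) hv'
      obtain ⟨t', ht', z, h4, h5⟩ := ih (k + 1) (by omega) w h3 h2
      refine ⟨_, ?_, z, .loop_step (h8 ▸ hpos k (by omega)) (.seq hv h1) h4, h5⟩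
      linarith
  intro u hu
  obtain ⟨v, h1, h2, h3⟩ := e.spec_compile hd (hf 0 (Nat.zero_le M)) hu
  obtain ⟨t, ht, w, h4, h5⟩ := key M 0 (Nat.zero_add M) v h3 h2
  exact ⟨_, by omega, w, .seq h1 h4, h5⟩

end

/-! ### The program that builds the digraph -/

section

/-- The state with the given contents of the registers `0, …, 6`, with the function `hi` for the
other registers, and with memory `M`. -/
def stateOf (r₀ r₁ r₂ r₃ r₄ r₅ r₆ : ℕ) (hi : ℕ → ℕ) (M : ℕ → ℕ → ℕ) : State where
  reg
    | 0 => r₀ | 1 => r₁ | 2 => r₂ | 3 => r₃ | 4 => r₄ | 5 => r₅ | 6 => r₆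
    | r => hi r
  mem := M

section stateOf

variable (r₀ r₁ r₂ r₃ r₄ r₅ r₆ v : ℕ) (hi : ℕ → ℕ) (M : ℕ → ℕ → ℕ)

theorem stateOf_setReg_zero : (stateOf r₀ r₁ r₂ r₃ r₄ r₅ r₆ hi M).setReg 0 v =
    stateOf v r₁ r₂ r₃ r₄ r₅ r₆ hi M := by
  simp only [stateOf, State.setReg, State.mk.injEq, and_true]
  funext r
  match r with | 0 | 1 | 2 | 3 | 4 | 5 | 6 | r + 7 => simp

theorem stateOf_setReg_two : (stateOf r₀ r₁ r₂ r₃ r₄ r₅ r₆ hi M).setReg 2 v =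
    stateOf r₀ r₁ v r₃ r₄ r₅ r₆ hi M := by
  simp only [stateOf, State.setReg, State.mk.injEq, and_true]
  funext r
  match r with | 0 | 1 | 2 | 3 | 4 | 5 | 6 | r + 7 => simp

theorem stateOf_setReg_three : (stateOf r₀ r₁ r₂ r₃ r₄ r₅ r₆ hi M).setReg 3 v =
    stateOf r₀ r₁ r₂ v r₄ r₅ r₆ hi M := by
  simp only [stateOf, State.setReg, State.mk.injEq, and_true]
  funext r
  match r with | 0 | 1 | 2 | 3 | 4 | 5 | 6 | r + 7 => simp

theorem stateOf_setReg_four : (stateOf r₀ r₁ r₂ r₃ r₄ r₅ r₆ hi M).setReg 4 v =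
    stateOf r₀ r₁ r₂ r₃ v r₅ r₆ hi M := by
  simp only [stateOf, State.setReg, State.mk.injEq, and_true]
  funext r
  match r with | 0 | 1 | 2 | 3 | 4 | 5 | 6 | r + 7 => simp

theorem stateOf_setReg_five : (stateOf r₀ r₁ r₂ r₃ r₄ r₅ r₆ hi M).setReg 5 v =
    stateOf r₀ r₁ r₂ r₃ r₄ v r₆ hi M := by
  simp only [stateOf, State.setReg, State.mk.injEq, and_true]
  funext r
  match r with | 0 | 1 | 2 | 3 | 4 | 5 | 6 | r + 7 => simp

theorem stateOf_setReg_six : (stateOf r₀ r₁ r₂ r₃ r₄ r₅ r₆ hi M).setReg 6 v =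
    stateOf r₀ r₁ r₂ r₃ r₄ r₅ v hi M := by
  simp only [stateOf, State.setReg, State.mk.injEq, and_true]
  funext r
  match r with | 0 | 1 | 2 | 3 | 4 | 5 | 6 | r + 7 => simp

theorem stateOf_setReg_of_le {x : ℕ} (hx : 7 ≤ x) :
    (stateOf r₀ r₁ r₂ r₃ r₄ r₅ r₆ hi M).setReg x v =
      stateOf r₀ r₁ r₂ r₃ r₄ r₅ r₆ (Function.update hi x v) M := by
  simp only [stateOf, State.setReg, State.mk.injEq, and_true]
  funext r
  match r with
  | 0 | 1 | 2 | 3 | 4 | 5 | 6 =>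
    exact Function.update_of_ne (by omega) _ _
  | r + 7 => simp only [Function.update_apply]

end stateOf

/-- The memory that holds the entries of the vectors in array `0`, and the tails and heads of the
arcs found so far in the arrays `1` and `2`. -/
def arcMemory (X : ℕ → ℕ) (tails heads : List ℕ) : ℕ → ℕ → ℕ
  | 0 => X
  | 1 => fun i => tails.getD i 0
  | 2 => fun i => heads.getD i 0
  | _ => fun _ => 0

theorem update_getD {α : Type*} (l : List α) (a z : α) :
    Function.update (fun i => l.getD i z) l.length a = fun i => (l ++ [a]).getD i z := by
  funext i
  rw [Function.update_apply]
  rcases lt_trichotomy i l.length with h | h | h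
  · rw [List.getD_append _ _ _ _ h, if_neg h.ne]
  · simp [h]
  · rw [List.getD_eq_default (l ++ [a]) _ (by simp; omega), List.getD_eq_default l _ h.le,
      if_neg h.ne']

/-- While the digraph is built, the registers `0, …, 3` hold the number and the length of the
vectors, a loop counter, and the number of arcs found so far. -/
def buildState (N d k m : ℕ) (X : ℕ → ℕ) (tails heads : List ℕ) : State :=
  stateOf N d k m 0 0 0 (fun _ => 0) (arcMemory X tails heads)

theorem buildState_setMem_one (N d k m : ℕ) (X : ℕ → ℕ) (t h : List ℕ) (v : ℕ) :
    (buildState N d k m X t h).setMem 1 t.length v = buildState N d k m X (t ++ [v]) h := by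
  simp only [buildState, State.setMem, stateOf, State.mk.injEq, true_and]
  funext a
  match a with
  | 1 => simp only [Function.update_self, arcMemory, update_getD]
  | 0 | 2 | a + 3 => simp [arcMemory]

theorem buildState_setMem_two (N d k m : ℕ) (X : ℕ → ℕ) (t h : List ℕ) (v : ℕ) :
    (buildState N d k m X t h).setMem 2 h.length v = buildState N d k m X t (h ++ [v]) := by
  simp only [buildState, State.setMem, stateOf, State.mk.injEq, true_and]
  funext a
  match a with
  | 2 => simp only [Function.update_self, arcMemory, update_getD]
  | 0 | 1 | a + 3 => simp [arcMemory]

/-- `IsValue B e s v`: in the state `s`, the expression `e` has the value `v`, and it can be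
evaluated with words bounded by `B`. -/
def Expr.IsValue (B : ℕ) (e : Expr) (s : State) (v : ℕ) : Prop := e.Fits B s ∧ e.eval s = v

/-- Append the arcs from `e` to `f` to the list, for all values of register `2` below the value
of `lim`. -/
def Prog.emitArcs (lim e f : Expr) : Prog :=
  .seq (.assign 2 (.const 0)) <| .while (.bin .lt (.var 2) lim) <|
    .seq (.write 1 (.var 3) e) <| .seq (.write 2 (.var 3) f) <|
      .seq (.assign 3 (.bin .add (.var 3) (.const 1)))
        (.assign 2 (.bin .add (.var 2) (.const 1)))

variable {B : ℕ}

/-- The lists of tails and heads are separate here, since between the two writes of one step they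
have different lengths. -/
theorem Spec.emitArcs_aux {N d k₀ m M : ℕ} {X : ℕ → ℕ} {lim e f : Expr} {t h : List ℕ}
    (ht : t.length = m) (hh : h.length = m) (F : ℕ → ℕ × ℕ)
    (hdl : lim.depth ≤ 7) (hde : e.depth ≤ 7) (hdf : f.depth ≤ 7)
    (hB : m + M + 1 ≤ B)
    (hlim : ∀ k ≤ M, ∀ m t h, lim.IsValue B (buildState N d k m X t h) M)
    (he : ∀ k < M, ∀ m t h, e.IsValue B (buildState N d k m X t h) (F k).1)
    (hf : ∀ k < M, ∀ m t h, f.IsValue B (buildState N d k m X t h) (F k).2) :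
    Spec B (.emitArcs lim e f) (buildState N d k₀ m X t h)
      ((M + 1) * (lim.cost + e.cost + f.cost + 20))
      (buildState N d M (m + M) X (t ++ (List.range M).map fun k => (F k).1)
        (h ++ (List.range M).map fun k => (F k).2)) := by
  have hset (k k' m : ℕ) (t h : List ℕ) :
      (buildState N d k m X t h).setReg 2 k' = buildState N d k' m X t h :=
    stateOf_setReg_two ..
  have hset' (k m m' : ℕ) (t h : List ℕ) :
      (buildState N d k m X t h).setReg 3 m' = buildState N d k m' X t h :=
    stateOf_setReg_three ..
  have s0 : Spec B (.assign 2 (.const 0)) (buildState N d k₀ m X t h) 2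
      (buildState N d 0 m X t h) := by
    rw [← hset k₀ 0]
    exact Spec.assign (e := .const 0) (by decide) (Nat.zero_le B) (Nat.zero_le B)
  have s1 := Spec.while (B := B) (e := .bin .lt (.var 2) lim) (M := M)
    (p := .seq (.write 1 (.var 3) e) <| .seq (.write 2 (.var 3) f) <|
      .seq (.assign 3 (.bin .add (.var 3) (.const 1)))
        (.assign 2 (.bin .add (.var 2) (.const 1))))
    (T := e.cost + f.cost + 12)
    (fun k => buildState N d k (m + k) X (t ++ (List.range k).map fun k => (F k).1)
        (h ++ (List.range k).map fun k => (F k).2))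
    (by simp [Expr.depth]; omega)
    (fun k hk => by
      simp only [List.range_succ, List.map_append, ← List.append_assoc, List.map_cons,
        List.map_nil]
      have hlt : (t ++ (List.range k).map fun k => (F k).1).length = m + k := by simp [ht]
      have hlh : (h ++ (List.range k).map fun k => (F k).2).length = m + k := by simp [hh]
      generalize (t ++ (List.range k).map fun k => (F k).1) = t at *
      generalize (h ++ (List.range k).map fun k => (F k).2) = h at *
      have w1 := Spec.write (B := B) (s := buildState N d k (m + k) X t h) (a := 1)
        (e := .var 3) (f := e) (by decide) hde (show m + k ≤ B by omega) (he k hk _ _ _).1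
      rw [(he k hk _ _ _).2, show Expr.eval (buildState N d k (m + k) X t h) (.var 3) = t.length
        from hlt.symm, buildState_setMem_one] at w1
      have w2 := Spec.write (B := B) (s := buildState N d k (m + k) X (t ++ [(F k).1]) h) (a := 2)
        (e := .var 3) (f := f) (by decide) hdf (show m + k ≤ B by omega) (hf k hk _ _ _).1
      rw [(hf k hk _ _ _).2, show Expr.eval (buildState N d k (m + k) X (t ++ [(F k).1]) h)
        (.var 3) = h.length from hlh.symm, buildState_setMem_two] at w2
      have a1 := Spec.assign (B := B) (x := 3) (e := .bin .add (.var 3) (.const 1))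
        (s := buildState N d k (m + k) X (t ++ [(F k).1]) (h ++ [(F k).2])) (by decide)
        ⟨show m + k ≤ B by omega, show 1 ≤ B by omega, show m + k + 1 ≤ B by omega⟩
        (show m + k + 1 ≤ B by omega)
      rw [show Expr.eval (buildState N d k (m + k) X (t ++ [(F k).1]) (h ++ [(F k).2]))
        (.bin .add (.var 3) (.const 1)) = m + (k + 1) from rfl, hset'] at a1
      have a2 := Spec.assign (B := B) (x := 2) (e := .bin .add (.var 2) (.const 1))
        (s := buildState N d k (m + (k + 1)) X (t ++ [(F k).1]) (h ++ [(F k).2])) (by decide)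
        ⟨show k ≤ B by omega, show 1 ≤ B by omega, show k + 1 ≤ B by omega⟩
        (show k + 1 ≤ B by omega)
      rw [show Expr.eval (buildState N d k (m + (k + 1)) X (t ++ [(F k).1]) (h ++ [(F k).2]))
        (.bin .add (.var 2) (.const 1)) = k + 1 from rfl, hset] at a2
      refine (w1.seq (w2.seq (a1.seq a2))).mono ?_
      simp only [Expr.cost]
      omega)
    (fun k hk => by
      refine ⟨show k ≤ B by omega, (hlim k hk _ _ _).1, ?_⟩
      refine le_trans ?_ (show 1 ≤ B by omega)
      simp only [BinOp.eval]
      split_ifs <;> omega)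
    (fun k hk => by
      simp only [Expr.eval, BinOp.eval, (hlim k hk.le _ _ _).2]
      exact (if_pos hk).trans_ne one_ne_zero)
    (by
      simp only [Expr.eval, BinOp.eval, (hlim M le_rfl _ _ _).2]
      exact if_neg (lt_irrefl M))
  simp only [List.range_zero, List.map_nil, List.append_nil, Nat.add_zero] at s1
  refine (s0.seq s1).mono ?_
  simp only [Expr.cost]
  generalize e.cost = x, f.cost = y, lim.cost = z
  linarith [Nat.zero_le (M * (lim.cost + 20)), Nat.zero_le x, Nat.zero_le y, Nat.zero_le z,
    Nat.zero_le M, Nat.zero_le (M * x), Nat.zero_le (M * y), Nat.zero_le (M * z)]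

/-- `buildState` with the arcs as a list of pairs. -/
def listState (N d k : ℕ) (X : ℕ → ℕ) (l : List (ℕ × ℕ)) : State :=
  buildState N d k l.length X (l.map Prod.fst) (l.map Prod.snd)

theorem Spec.emitArcs {N d k₀ M : ℕ} {X : ℕ → ℕ} {lim e f : Expr} (F : ℕ → ℕ × ℕ)
    (hdl : lim.depth ≤ 7) (hde : e.depth ≤ 7) (hdf : f.depth ≤ 7)
    (hc : lim.cost + e.cost + f.cost ≤ 40)
    (hlim : ∀ k ≤ M, ∀ m t h, lim.IsValue B (buildState N d k m X t h) M)
    (he : ∀ k < M, ∀ m t h, e.IsValue B (buildState N d k m X t h) (F k).1)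
    (hf : ∀ k < M, ∀ m t h, f.IsValue B (buildState N d k m X t h) (F k).2)
    {l : List (ℕ × ℕ)} (hB : l.length + M + 1 ≤ B) :
    Spec B (.emitArcs lim e f) (listState N d k₀ X l) ((M + 1) * 60)
      (listState N d M X (l ++ (List.range M).map F)) := by
  have h := Spec.emitArcs_aux (k₀ := k₀) (t := l.map Prod.fst) (h := l.map Prod.snd)
    (List.length_map _) (List.length_map _) F hdl hde hdf hB hlim he hf
  simp only [listState, List.map_append, List.map_map, List.length_append, List.length_map,
    List.length_range]
  exact h.mono (Nat.mul_le_mul_left _ (by omega))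

end

section

namespace Expr

instance (n : ℕ) : OfNat Expr n := ⟨.const n⟩
instance : Add Expr := ⟨.bin .add⟩
instance : Sub Expr := ⟨.bin .sub⟩
instance : Mul Expr := ⟨.bin .mul⟩
instance : Div Expr := ⟨.bin .div⟩
instance : Mod Expr := ⟨.bin .mod⟩

variable {B : ℕ} {s : State} {e f : Expr} {u v : ℕ}

theorem IsValue.var {r : Fin 8} (h : s.reg r = v) (hv : v ≤ B) : (var r).IsValue B s v :=
  ⟨h.trans_le hv, h⟩

theorem IsValue.ofNat (n : ℕ) (hn : n ≤ B) : IsValue B (OfNat.ofNat n) s n := ⟨hn, rfl⟩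

theorem IsValue.bin (o : BinOp) (he : e.IsValue B s u) (hf : f.IsValue B s v)
    (h : o.eval u v ≤ B) : (bin o e f).IsValue B s (o.eval u v) := by
  obtain ⟨he, rfl⟩ := he
  obtain ⟨hf, rfl⟩ := hf
  exact ⟨⟨he, hf, h⟩, rfl⟩

theorem IsValue.add (he : e.IsValue B s u) (hf : f.IsValue B s v) (h : u + v ≤ B) :
    (e + f).IsValue B s (u + v) := he.bin .add hf h

theorem IsValue.mul (he : e.IsValue B s u) (hf : f.IsValue B s v) (h : u * v ≤ B) :
    (e * f).IsValue B s (u * v) := he.bin .mul hf h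

theorem IsValue.sub (he : e.IsValue B s u) (hf : f.IsValue B s v) (h : u - v ≤ B) :
    (e - f).IsValue B s (u - v) := he.bin .sub hf h

theorem IsValue.div (he : e.IsValue B s u) (hf : f.IsValue B s v) (h : u / v ≤ B) :
    (e / f).IsValue B s (u / v) := he.bin .div hf h

theorem IsValue.mod (he : e.IsValue B s u) (hf : f.IsValue B s v) (h : u % v ≤ B) :
    (e % f).IsValue B s (u % v) := he.bin .mod hf h

theorem IsValue.load {a : ℕ} {X : ℕ → ℕ} (he : e.IsValue B s u) (hX : s.mem a = X) :
    (Expr.load a e).IsValue B s (X u) := ⟨he.1, by rw [Expr.eval, he.2, hX]⟩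

end Expr

variable {B : ℕ}

/-- The arcs inside the chains. -/
def stepArc (k : ℕ) : ℕ × ℕ := (4 * (k / 3) + k % 3, 4 * (k / 3) + k % 3 + 1)

/-- The arcs from the sources to the hubs. -/
def toHubArc (N d k : ℕ) : ℕ × ℕ := (4 * (k / 4), 5 * N + 3 * d + k % 4)

/-- The arcs from the ends of the chains to the coordinates. -/
def toCoordArc (N d : ℕ) (X : ℕ → ℕ) (k : ℕ) : ℕ × ℕ :=
  (4 * (k / d) + 3, 4 * N + 3 * (k % d) + X k)

/-- The arcs from the coordinates to the targets. -/
def toTargetArc (N d : ℕ) (X : ℕ → ℕ) (k : ℕ) : ℕ × ℕ :=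
  (4 * N + 3 * (k % d) + (2 - X k), 4 * N + 3 * d + k / d)

/-- The arcs from the hubs to the leaves. -/
def toLeafArc (N d k : ℕ) : ℕ × ℕ :=
  (5 * N + 3 * d + k / (4 * (N + d)), 5 * N + 3 * d + 4 + k)

/-- The list of all arcs, as pairs of vertex numbers. -/
def arcNumbers (N d : ℕ) (X : ℕ → ℕ) : List (ℕ × ℕ) :=
  (List.range (N * 3)).map stepArc ++ (List.range (N * 4)).map (toHubArc N d) ++
    (List.range (N * d)).map (toCoordArc N d X) ++
    (List.range (N * d)).map (toTargetArc N d X) ++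
    (List.range (4 * (4 * (N + d)))).map (toLeafArc N d)

/-- The number of arcs (and of vertices). -/
def arcTotal (N d : ℕ) : ℕ := N * 3 + N * 4 + N * d + N * d + 4 * (4 * (N + d))

theorem length_arcNumbers (N d : ℕ) (X : ℕ → ℕ) : (arcNumbers N d X).length = arcTotal N d := by
  simp only [arcNumbers, arcTotal, List.length_append, List.length_map, List.length_range]

/-- The program that computes the list of all arcs, and the number of vertices, which is equal
to the number of arcs. -/
def buildProg : Prog :=
  let N : Expr := .var 0
  let d : Expr := .var 1
  let k : Expr := .var 2
  .seq (.emitArcs (N * 3) (4 * (k / 3) + k % 3) (4 * (k / 3) + k % 3 + 1)) <|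
  .seq (.emitArcs (N * 4) (4 * (k / 4)) (5 * N + 3 * d + k % 4)) <|
  .seq (.emitArcs (N * d) (4 * (k / d) + 3) (4 * N + 3 * (k % d) + .load 0 k)) <|
  .seq (.emitArcs (N * d) (4 * N + 3 * (k % d) + (2 - .load 0 k)) (4 * N + 3 * d + k / d)) <|
  .seq (.emitArcs (4 * (4 * (N + d))) (5 * N + 3 * d + k / (4 * (N + d)))
    (5 * N + 3 * d + 4 + k)) <|
  .seq (.copy 16 3) (.copy 17 3)

theorem spec_buildProg {N d : ℕ} (hN : 2 ≤ N) {X : ℕ → ℕ} (hX : ∀ k, X k ≤ 1)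
    (hB : 100 * (N + d + N * d) ≤ B) :
    Spec B buildProg (listState N d 0 X []) (60 * (arcTotal N d + 6))
      (stateOf N d (4 * (4 * (N + d))) (arcTotal N d) 0 0 0
        (Function.update (Function.update (fun _ => 0) 16 (arcTotal N d)) 17 (arcTotal N d))
        (arcMemory X ((arcNumbers N d X).map Prod.fst) ((arcNumbers N d X).map Prod.snd))) := by
  have vN (k m t h) : (Expr.var 0).IsValue B (buildState N d k m X t h) N :=
    .var rfl (by omega)
  have vd (k m t h) : (Expr.var 1).IsValue B (buildState N d k m X t h) d :=
    .var rfl (by omega)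
  have vk (k m t h) (hk : k ≤ B) : (Expr.var 2).IsValue B (buildState N d k m X t h) k :=
    .var rfl hk
  have vX (k m t h) (hk : k ≤ B) :
      (Expr.load 0 (.var 2)).IsValue B (buildState N d k m X t h) (X k) := (vk k m t h hk).load rfl
  have c {s : State} (n : ℕ) (hn : n ≤ 5) : Expr.IsValue B (OfNat.ofNat n) s n :=
    .ofNat n (by omega)
  have hd (k n : ℕ) : k / n ≤ k := Nat.div_le_self k n
  have hm (k n : ℕ) : k % n ≤ k := Nat.mod_le k n
  have nd (k m t h) : (5 * .var 0 + 3 * .var 1 : Expr).IsValue B (buildState N d k m X t h)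
      (5 * N + 3 * d) :=
    ((c 5 (by omega)).mul (vN ..) (by omega)).add ((c 3 (by omega)).mul (vd ..) (by omega))
      (by omega)
  have nd' (k m t h) : (4 * .var 0 + 3 * .var 1 : Expr).IsValue B (buildState N d k m X t h)
      (4 * N + 3 * d) :=
    ((c 4 (by omega)).mul (vN ..) (by omega)).add ((c 3 (by omega)).mul (vd ..) (by omega))
      (by omega)
  have nk (k m t h) (hk : k ≤ N * d) : (4 * .var 0 + 3 * (.var 2 % .var 1) : Expr).IsValue B
      (buildState N d k m X t h) (4 * N + 3 * (k % d)) := by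
    have := hm k d
    exact ((c 4 (by omega)).mul (vN ..) (by omega)).add ((c 3 (by omega)).mul
      ((vk _ _ _ _ (by omega)).mod (vd ..) (by omega)) (by omega)) (by omega)
  have kl (k m t h) (hk : k ≤ N * 3) : (4 * (.var 2 / 3) + .var 2 % 3 : Expr).IsValue B
      (buildState N d k m X t h) (4 * (k / 3) + k % 3) :=
    ((c 4 (by omega)).mul ((vk _ _ _ _ (by omega)).div (c 3 (by omega)) (by omega))
      (by omega)).add ((vk _ _ _ _ (by omega)).mod (c 3 (by omega)) (by omega)) (by omega)
  have ll (k m t h) : (4 * (.var 0 + .var 1) : Expr).IsValue B (buildState N d k m X t h)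
      (4 * (N + d)) := (c 4 (by omega)).mul ((vN ..).add (vd ..) (by omega)) (by omega)
  have lnd (k m t h) : (.var 0 * .var 1 : Expr).IsValue B (buildState N d k m X t h)
      (N * d) := (vN ..).mul (vd ..) (by omega)
  have s1 := Spec.emitArcs (B := B) (N := N) (d := d) (k₀ := 0) (M := N * 3) (X := X)
    (lim := .var 0 * 3) (e := 4 * (.var 2 / 3) + .var 2 % 3)
    (f := 4 * (.var 2 / 3) + .var 2 % 3 + 1) (l := []) stepArc
    (by decide) (by decide) (by decide) (by decide)
    (fun k hk m t h => (vN ..).mul (c 3 (by omega)) (by omega))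
    (fun k hk m t h => kl _ _ _ _ hk.le)
    (fun k hk m t h => (kl _ _ _ _ hk.le).add (c 1 (by omega)) (by omega))
    (by simp; omega)
  have s2 (l hl) := Spec.emitArcs (B := B) (N := N) (d := d) (k₀ := N * 3) (M := N * 4) (X := X)
    (lim := .var 0 * 4) (e := 4 * (.var 2 / 4)) (f := 5 * .var 0 + 3 * .var 1 + .var 2 % 4)
    (l := l) (toHubArc N d) (by decide) (by decide) (by decide) (by decide)
    (fun k hk m t h => (vN ..).mul (c 4 (by omega)) (by omega))
    (fun k hk m t h => (c 4 (by omega)).mul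
      ((vk _ _ _ _ (by omega)).div (c 4 (by omega)) (by omega)) (by omega))
    (fun k hk m t h => (nd ..).add ((vk _ _ _ _ (by omega)).mod (c 4 (by omega)) (by omega))
      (by omega)) hl
  have s3 (l hl) := Spec.emitArcs (B := B) (N := N) (d := d) (k₀ := N * 4) (M := N * d) (X := X)
    (lim := .var 0 * .var 1) (e := 4 * (.var 2 / .var 1) + 3)
    (f := 4 * .var 0 + 3 * (.var 2 % .var 1) + .load 0 (.var 2))
    (l := l) (toCoordArc N d X) (by decide) (by decide) (by decide) (by decide)
    (fun k hk m t h => lnd ..)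
    (fun k hk m t h => by
      have := hd k d
      exact ((c 4 (by omega)).mul ((vk _ _ _ _ (by omega)).div (vd ..) (by omega))
        (by omega)).add (c 3 (by omega)) (by omega))
    (fun k hk m t h => by
      have := hm k d
      have := hX k
      exact (nk _ _ _ _ hk.le).add (vX _ _ _ _ (by omega)) (by omega)) hl
  have s4 (l hl) := Spec.emitArcs (B := B) (N := N) (d := d) (k₀ := N * d) (M := N * d) (X := X)
    (lim := .var 0 * .var 1) (e := 4 * .var 0 + 3 * (.var 2 % .var 1) + (2 - .load 0 (.var 2)))
    (f := 4 * .var 0 + 3 * .var 1 + .var 2 / .var 1)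
    (l := l) (toTargetArc N d X) (by decide) (by decide) (by decide) (by decide)
    (fun k hk m t h => lnd ..)
    (fun k hk m t h => by
      have := hm k d
      exact (nk _ _ _ _ hk.le).add ((c 2 (by omega)).sub (vX _ _ _ _ (by omega)) (by omega))
        (by omega))
    (fun k hk m t h => by
      have := hd k d
      exact (nd' ..).add ((vk _ _ _ _ (by omega)).div (vd ..) (by omega)) (by omega)) hl
  have s5 (l hl) := Spec.emitArcs (B := B) (N := N) (d := d) (k₀ := N * d)
    (M := 4 * (4 * (N + d))) (X := X) (lim := 4 * (4 * (.var 0 + .var 1)))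
    (e := 5 * .var 0 + 3 * .var 1 + .var 2 / (4 * (.var 0 + .var 1)))
    (f := 5 * .var 0 + 3 * .var 1 + 4 + .var 2)
    (l := l) (toLeafArc N d) (by decide) (by decide) (by decide) (by decide)
    (fun k hk m t h => (c 4 (by omega)).mul (ll ..) (by omega))
    (fun k hk m t h => by
      have := hd k (4 * (N + d))
      exact (nd ..).add ((vk _ _ _ _ (by omega)).div (ll ..) (by omega)) (by omega))
    (fun k hk m t h => ((nd ..).add (c 4 (by omega)) (by omega)).add (vk _ _ _ _ (by omega))
      (by omega)) hl
  have s6 : Spec B (.seq (.copy 16 3) (.copy 17 3))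
      (listState N d (4 * (4 * (N + d))) X (arcNumbers N d X)) 2
      (stateOf N d (4 * (4 * (N + d))) (arcTotal N d) 0 0 0
        (Function.update (Function.update (fun _ => 0) 16 (arcTotal N d)) 17 (arcTotal N d))
        (arcMemory X ((arcNumbers N d X).map Prod.fst) ((arcNumbers N d X).map Prod.snd))) := by
    have hm : arcTotal N d ≤ B := by
      unfold arcTotal
      omega
    rw [listState, length_arcNumbers, buildState, ← stateOf_setReg_of_le _ _ _ _ _ _ _ _ _ _
      (show 7 ≤ 17 by omega), ← stateOf_setReg_of_le _ _ _ _ _ _ _ _ _ _ (show 7 ≤ 16 by omega)]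
    exact (Spec.copy (by omega) hm).seq (Spec.copy (by omega) hm)
  refine (s1.seq <| (s2 _ ?_).seq <| (s3 _ ?_).seq <| (s4 _ ?_).seq <|
    (s5 _ ?_).seq s6).mono ?_
  case refine_5 =>
    unfold arcTotal
    omega
  all_goals
    simp only [List.nil_append, List.length_append, List.length_map, List.length_range]
    omega

/-! ### The program that tests one vector -/

/-- Let register `16` hold the number of a source. The program counts the vectors that are
orthogonal to the corresponding vector, and answers `1` if there is one and `0` otherwise. -/
def checkProg : Prog :=
  let N : Expr := .var 0
  let d : Expr := .var 1
  let j : Expr := .var 2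
  let a : Expr := .var 3
  let i : Expr := .var 4
  let acc : Expr := .var 5
  let found : Expr := .var 6
  .seq (.copy 4 16) <| .seq (.assign 4 (i / 4)) <| .seq (.assign 2 0) <| .seq (.assign 3 0) <|
  .seq (.while (.bin .lt j N) <|
    .seq (.while (.bin .lt a d) <|
      .seq (.assign 5 (acc + .load 0 (i * d + a) * .load 0 (j * d + a))) (.assign 3 (a + 1))) <|
    .seq (.assign 6 (found + .bin .eq acc 0)) <| .seq (.assign 5 0) <| .seq (.assign 3 0) <|
      .assign 2 (j + 1)) <|
  .assign 0 (.bin .lt 0 found)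

/-- The inner product of the vectors `i` and `j`. -/
def innerSum (d : ℕ) (X : ℕ → ℕ) (i j : ℕ) : ℕ :=
  ∑ a ∈ Finset.range d, X (i * d + a) * X (j * d + a)

/-- How many of the first `n` vectors are orthogonal to the vector `i`. -/
def orthCount (d : ℕ) (X : ℕ → ℕ) (i n : ℕ) : ℕ :=
  ∑ j ∈ Finset.range n, if innerSum d X i j = 0 then 1 else 0

theorem orthCount_le (d : ℕ) (X : ℕ → ℕ) (i n : ℕ) : orthCount d X i n ≤ n := by
  refine (Finset.sum_le_card_nsmul _ _ 1 fun j _ => ?_).trans_eq (by simp)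
  split_ifs <;> omega

theorem orthCount_pos_iff (d : ℕ) (X : ℕ → ℕ) (i n : ℕ) :
    0 < orthCount d X i n ↔ ∃ j < n, innerSum d X i j = 0 := by
  simp [orthCount, Finset.Nonempty]

/-- A form of `Spec.assign` that names the new value and the new state. -/
theorem Spec.assign_value {s s' : State} {x v c : ℕ} {e : Expr} (he : e.IsValue B s v)
    (hv : v ≤ B) (hs : s.setReg x v = s') (hc : e.cost + 1 ≤ c) (hd : e.depth ≤ 8) :
    Spec B (.assign x e) s c s' := by
  obtain ⟨he, rfl⟩ := he
  subst hs
  exact (Spec.assign hd he hv).mono hc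

theorem spec_checkProg {N d r₂ r₃ i : ℕ} (hi : i < N) {X : ℕ → ℕ} (hX : ∀ k, X k ≤ 1)
    (hB : 100 * (N + d + N * d) ≤ B) {hireg : ℕ → ℕ} {M : ℕ → ℕ → ℕ} (hM : M 0 = X)
    (h16 : hireg 16 = 4 * i) :
    ∃ s', Spec B checkProg (stateOf N d r₂ r₃ 0 0 0 hireg M) (40 * (N + 1) * (d + 1) + 30) s' ∧
      s'.reg 0 = if ∃ j < N, innerSum d X i j = 0 then 1 else 0 := by
  have c {s : State} (n : ℕ) (hn : n ≤ 5) : Expr.IsValue B (OfNat.ofNat n) s n :=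
    .ofNat n (by omega)
  have vX {s : State} {e : Expr} {u : ℕ} (hs : s.mem = M) (he : e.IsValue B s u) :
      (Expr.load 0 e).IsValue B s (X u) := he.load (by rw [hs, hM])
  have idx {j a : ℕ} (hj : j < N) (ha : a < d) : j * d + a ≤ N * d := by
    calc j * d + a ≤ j * d + d := by omega
      _ = (j + 1) * d := by ring
      _ ≤ N * d := Nat.mul_le_mul_right d hj
  have hprod (j a : ℕ) : X (i * d + a) * X (j * d + a) ≤ 1 := by
    calc _ ≤ 1 * 1 := Nat.mul_le_mul (hX _) (hX _)
      _ = 1 := rfl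
  have lt01 (u v : ℕ) : (BinOp.lt.eval u v) ≤ 1 := by
    simp only [BinOp.eval]
    split_ifs <;> omega
  have eq01 (u v : ℕ) : (BinOp.eq.eval u v) ≤ 1 := by
    simp only [BinOp.eval]
    split_ifs <;> omega
  have v (j a acc found : ℕ) (h : j ≤ N ∧ a ≤ d ∧ acc ≤ d ∧ found ≤ N) :
      let s := stateOf N d j a i acc found hireg M
      (Expr.var 0).IsValue B s N ∧ (Expr.var 1).IsValue B s d ∧ (Expr.var 2).IsValue B s j ∧
      (Expr.var 3).IsValue B s a ∧ (Expr.var 4).IsValue B s i ∧ (Expr.var 5).IsValue B s acc ∧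
      (Expr.var 6).IsValue B s found :=
    ⟨.var rfl (by omega), .var rfl (by omega), .var rfl (by omega), .var rfl (by omega),
      .var rfl (by omega), .var rfl (by omega), .var rfl (by omega)⟩
  have p1 : Spec B (.copy 4 16) (stateOf N d r₂ r₃ 0 0 0 hireg M) 1
      (stateOf N d r₂ r₃ (4 * i) 0 0 hireg M) := by
    rw [← stateOf_setReg_four N d r₂ r₃ 0 0 0 (4 * i), ← h16]
    exact Spec.copy (s := stateOf N d r₂ r₃ 0 0 0 hireg M) (y := 16) (by omega)
      (show hireg 16 ≤ B by omega)
  have p2 : Spec B (.assign 4 (.var 4 / 4)) (stateOf N d r₂ r₃ (4 * i) 0 0 hireg M) 4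
      (stateOf N d r₂ r₃ i 0 0 hireg M) := by
    refine Spec.assign_value (v := i) ?_ (by omega) (stateOf_setReg_four ..) (by decide)
      (by decide)
    have h : 4 * i / 4 = i := by omega
    have := Expr.IsValue.div (B := B) (s := stateOf N d r₂ r₃ (4 * i) 0 0 hireg M) (e := .var 4)
      (.var (v := 4 * i) rfl (by omega)) (c 4 (by omega)) (by omega)
    rwa [h] at this
  have p3 : Spec B (.assign 2 0) (stateOf N d r₂ r₃ i 0 0 hireg M) 2
      (stateOf N d 0 r₃ i 0 0 hireg M) :=
    Spec.assign_value (c 0 (by omega)) (by omega) (stateOf_setReg_two ..) (by decide) (by decide)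
  have p4 : Spec B (.assign 3 0) (stateOf N d 0 r₃ i 0 0 hireg M) 2
      (stateOf N d 0 0 i 0 0 hireg M) :=
    Spec.assign_value (c 0 (by omega)) (by omega) (stateOf_setReg_three ..) (by decide)
      (by decide)
  have inner (j found : ℕ) (hj : j < N) (hfound : found ≤ N) :=
    Spec.while (B := B) (e := .bin .lt (.var 3) (.var 1)) (M := d)
      (p := .seq (.assign 5 (.var 5 + .load 0 (.var 4 * .var 1 + .var 3) *
        .load 0 (.var 2 * .var 1 + .var 3))) (.assign 3 (.var 3 + 1))) (T := 20)
      (fun a => stateOf N d j a i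
        (∑ a ∈ Finset.range a, X (i * d + a) * X (j * d + a)) found hireg M) (by decide)
      (fun a ha => by
        have hsum : ∑ a ∈ Finset.range a, X (i * d + a) * X (j * d + a) ≤ a :=
          (Finset.sum_le_card_nsmul _ _ 1 fun a _ => hprod j a).trans_eq (by simp)
        have h1 := hprod j a
        have hia := idx hi ha
        have hja := idx hj ha
        rw [Finset.sum_range_succ]
        generalize ∑ a ∈ Finset.range a, X (i * d + a) * X (j * d + a) = acc at *
        obtain ⟨-, v1, v2, v3, v4, v5, -⟩ :=
          v j a acc found ⟨hj.le, ha.le, by omega, hfound⟩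
        obtain ⟨-, -, -, v3', -⟩ := v j a (acc + X (i * d + a) * X (j * d + a)) found
          ⟨hj.le, ha.le, by omega, hfound⟩
        exact (Spec.assign_value (c := 16)
          (v5.add ((vX rfl ((v4.mul v1 (by omega)).add v3 (by omega))).mul
            (vX rfl ((v2.mul v1 (by omega)).add v3 (by omega))) (by omega)) (by omega))
          (by omega) (stateOf_setReg_five ..) (by decide) (by decide)).seq
          (Spec.assign_value (c := 4) (v3'.add (c 1 (by omega)) (by omega)) (by omega)
            (stateOf_setReg_three ..) (by decide) (by decide)))
      (fun a ha => ⟨show a ≤ B by omega, show d ≤ B by omega, (lt01 _ _).trans (by omega)⟩)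
      (fun a ha => (if_pos ha).trans_ne one_ne_zero) (if_neg (lt_irrefl d))
  have outer := Spec.while (B := B) (e := .bin .lt (.var 2) (.var 0)) (M := N)
    (p := .seq (.while (.bin .lt (.var 3) (.var 1)) <|
        .seq (.assign 5 (.var 5 + .load 0 (.var 4 * .var 1 + .var 3) *
          .load 0 (.var 2 * .var 1 + .var 3))) (.assign 3 (.var 3 + 1))) <|
      .seq (.assign 6 (.var 6 + .bin .eq (.var 5) 0)) <| .seq (.assign 5 0) <|
        .seq (.assign 3 0) <| .assign 2 (.var 2 + 1)) (T := 24 * d + 20)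
    (fun j => stateOf N d j 0 i 0 (orthCount d X i j) hireg M) (by decide)
    (fun j hj => by
      have hcount := orthCount_le d X i j
      have hcount' := orthCount_le d X i (j + 1)
      have hsum : innerSum d X i j ≤ d :=
        (Finset.sum_le_card_nsmul _ _ 1 fun a _ => hprod j a).trans_eq (by simp)
      have hin := inner j (orthCount d X i j) hj (by omega)
      rw [show ∑ a ∈ Finset.range d, X (i * d + a) * X (j * d + a) = innerSum d X i j from rfl,
        Finset.sum_range_zero] at hin
      have hs : orthCount d X i (j + 1) =
          orthCount d X i j + BinOp.eq.eval (innerSum d X i j) 0 := Finset.sum_range_succ _ _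
      obtain ⟨-, -, -, -, -, v5, v6⟩ := v j d (innerSum d X i j) (orthCount d X i j)
        ⟨hj.le, le_rfl, hsum, by omega⟩
      obtain ⟨-, -, v2, -⟩ := v j 0 0 (orthCount d X i (j + 1))
        ⟨hj.le, by omega, by omega, by omega⟩
      have q1 : Spec B (.assign 6 (.var 6 + .bin .eq (.var 5) 0))
          (stateOf N d j d i (innerSum d X i j) (orthCount d X i j) hireg M) 6
          (stateOf N d j d i (innerSum d X i j) (orthCount d X i (j + 1)) hireg M) := by
        rw [hs] at hcount' ⊢
        exact Spec.assign_value (v6.add (v5.bin .eq (c 0 (by omega)) ((eq01 _ _).trans (by omega)))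
          (by omega)) (by omega) (stateOf_setReg_six ..) (by decide) (by decide)
      have q2 : Spec B (.assign 5 0)
          (stateOf N d j d i (innerSum d X i j) (orthCount d X i (j + 1)) hireg M) 2
          (stateOf N d j d i 0 (orthCount d X i (j + 1)) hireg M) :=
        Spec.assign_value (c 0 (by omega)) (by omega) (stateOf_setReg_five ..) (by decide)
          (by decide)
      have q3 : Spec B (.assign 3 0)
          (stateOf N d j d i 0 (orthCount d X i (j + 1)) hireg M) 2
          (stateOf N d j 0 i 0 (orthCount d X i (j + 1)) hireg M) :=
        Spec.assign_value (c 0 (by omega)) (by omega) (stateOf_setReg_three ..) (by decide)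
          (by decide)
      have q4 : Spec B (.assign 2 (.var 2 + 1))
          (stateOf N d j 0 i 0 (orthCount d X i (j + 1)) hireg M) 4
          (stateOf N d (j + 1) 0 i 0 (orthCount d X i (j + 1)) hireg M) :=
        Spec.assign_value (v2.add (c 1 (by omega)) (by omega)) (by omega)
          (stateOf_setReg_two ..) (by decide) (by decide)
      refine (hin.seq (q1.seq (q2.seq (q3.seq q4)))).mono ?_
      rw [show (Expr.bin .lt (.var 3) (.var 1)).cost = 3 from rfl]
      omega)
    (fun j hj => ⟨show j ≤ B by omega, show N ≤ B by omega, (lt01 _ _).trans (by omega)⟩)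
    (fun j hj => (if_pos hj).trans_ne one_ne_zero) (if_neg (lt_irrefl N))
  have hcount := orthCount_le d X i N
  obtain ⟨-, -, -, -, -, -, v6⟩ := v N 0 0 (orthCount d X i N)
    ⟨le_rfl, by omega, by omega, hcount⟩
  have p5 : Spec B (.assign 0 (.bin .lt 0 (.var 6)))
      (stateOf N d N 0 i 0 (orthCount d X i N) hireg M) 4
      (stateOf (BinOp.lt.eval 0 (orthCount d X i N)) d N 0 i 0 (orthCount d X i N) hireg M) :=
    Spec.assign_value ((c 0 (by omega)).bin .lt v6 ((lt01 _ _).trans (by omega)))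
      ((lt01 _ _).trans (by omega)) (stateOf_setReg_zero ..) (by decide) (by decide)
  refine ⟨_, (p1.seq <| p2.seq <| p3.seq <| p4.seq <| outer.seq p5).mono ?_, ?_⟩
  · rw [show (Expr.bin .lt (.var 2) (.var 0)).cost = 3 from rfl]
    nlinarith [Nat.zero_le (N * d)]
  · simp only [stateOf, BinOp.eval, orthCount_pos_iff]

end

/-! ### The list of arcs -/

section

open Vertex

/-- The values of a function on pairs, in the lexicographic order of the pairs. -/
def pairList {α : Type*} {m n : ℕ} (f : Fin m × Fin n → α) : List α :=
  List.ofFn fun k => f (finProdFinEquiv.symm k)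

section pairList

variable {α β : Type*} {m n : ℕ} {f : Fin m × Fin n → α}

theorem mem_pairList {a : α} : a ∈ pairList f ↔ ∃ i j, f (i, j) = a := by
  rw [pairList, List.mem_ofFn', Set.mem_range, ← finProdFinEquiv.exists_congr_right]
  simp

theorem nodup_pairList (hf : Function.Injective f) : (pairList f).Nodup :=
  List.nodup_ofFn.2 (hf.comp finProdFinEquiv.symm.injective)

theorem map_pairList (g : α → β) (F : ℕ → β)
    (h : ∀ k : Fin (m * n), g (f (k.divNat, k.modNat)) = F k) :
    (pairList f).map g = (List.range (m * n)).map F := by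
  rw [pairList, List.map_ofFn, ← List.map_coe_finRange_eq_range, List.map_map, List.ofFn_eq_map]
  exact List.map_congr_left fun k _ => h k

end pairList

variable {N d : ℕ} (L P : ℕ) (x : Fin N → Fin d → Bool)

/-- The list of the arcs of `vectorGraph L P x`. -/
def arcList : List (Vertex N d L P × Vertex N d L P) :=
  pairList (fun p : Fin N × Fin 3 => (chain p.1 p.2.castSucc, chain p.1 p.2.succ)) ++
    pairList (fun p : Fin N × Fin 4 => (chain p.1 0, hub p.2)) ++
    pairList (fun p : Fin N × Fin d => (chain p.1 3, coord p.2 (bif x p.1 p.2 then 1 else 0))) ++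
    pairList (fun p : Fin N × Fin d => (coord p.2 (bif x p.1 p.2 then 1 else 2), target p.1)) ++
    pairList (fun p : Fin 4 × Fin L => (hub p.1, leaf p.1 p.2))

theorem listsArcs_arcList : ListsArcs (vectorGraph L P x) (arcList L P x) := by
  constructor
  · simp only [arcList, List.nodup_append']
    refine ⟨⟨⟨⟨?_, ?_, ?_⟩, ?_, ?_⟩, ?_, ?_⟩, ?_, ?_⟩
    all_goals first
      | exact nodup_pairList fun ⟨i, j⟩ ⟨i', j'⟩ h => by simp_all
      | (simp only [List.disjoint_left, List.mem_append, mem_pairList]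
         aesop)
  · intro u v
    simp only [arcList, List.mem_append, mem_pairList, Prod.mk.injEq]
    constructor
    · rintro ((((⟨i, j, rfl, rfl⟩ | ⟨i, j, rfl, rfl⟩) | ⟨i, j, rfl, rfl⟩) | ⟨i, j, rfl, rfl⟩) |
        ⟨i, j, rfl, rfl⟩)
      · exact IsArc.step i j
      · exact IsArc.toHub i j
      · exact IsArc.toCoord i j
      · exact IsArc.toTarget i j
      · exact IsArc.toLeaf i j
    · intro h
      cases h with
      | step i l => exact .inl (.inl (.inl (.inl ⟨i, l, rfl, rfl⟩)))
      | toHub i h => exact .inl (.inl (.inl (.inr ⟨i, h, rfl, rfl⟩)))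
      | toCoord i a => exact .inl (.inl (.inr ⟨i, a, rfl, rfl⟩))
      | toTarget j a => exact .inl (.inr ⟨j, a, rfl, rfl⟩)
      | toLeaf h l => exact .inr ⟨h, l, rfl, rfl⟩

theorem ListsArcs.relabel {V W : Type*} {G : Digraph V} {arcs : List (V × V)}
    (h : ListsArcs G arcs) (e : V ≃ W) :
    ListsArcs (relabel e G) (arcs.map (Prod.map e e)) := by
  refine ⟨h.1.map (e.injective.prodMap e.injective), fun u v => ?_⟩
  obtain ⟨u, rfl⟩ := e.surjective u
  obtain ⟨v, rfl⟩ := e.surjective v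
  rw [show (e u, e v) = Prod.map e e (u, v) from rfl,
    List.mem_map_of_injective (e.injective.prodMap e.injective), h.2]
  simp [ClosenessHardness.relabel]

/-- The entry at position `k` of the list of all entries of the vectors. -/
def entry (k : ℕ) : ℕ := (vectorInput x).mem 0 k

theorem entry_le_one (k : ℕ) : entry x k ≤ 1 := by
  simp only [entry, vectorInput]
  split_ifs
  · exact Bool.toNat_le _
  · exact Nat.zero_le 1

theorem entry_eq (k : Fin (N * d)) : entry x k = (x k.divNat k.modNat).toNat := by
  simp [entry, vectorInput]

theorem entry_mul_add (i : Fin N) (a : Fin d) : entry x (i * d + a) = (x i a).toNat := by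
  have h := entry_eq x (finProdFinEquiv (i, a))
  have h1 : finProdFinEquiv.symm (finProdFinEquiv (i, a)) = (i, a) := Equiv.symm_apply_apply _ _
  have h2 : (finProdFinEquiv (i, a)).divNat = i := congrArg Prod.fst h1
  have h3 : (finProdFinEquiv (i, a)).modNat = a := congrArg Prod.snd h1
  rw [h2, h3] at h
  rw [← h]
  congr 1
  simp [mul_comm, add_comm]

theorem innerSum_entry (i j : Fin N) :
    innerSum d (entry x) i j = ∑ a, (x i a).toNat * (x j a).toNat := by
  rw [innerSum, Finset.sum_range]
  simp only [entry_mul_add]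

/-- The number of isolated vertices that makes the number of vertices equal to the number of
arcs. -/
def padCount (N d : ℕ) : ℕ := 2 * N + 2 * (N * d) - (3 * d + 4)

theorem vertexTotal_eq (hN : 2 ≤ N) :
    N * 4 + (d * 3 + (N + (4 + (4 * leafCount N d + padCount N d)))) = arcTotal N d := by
  have : 2 * d ≤ N * d := Nat.mul_le_mul_right d hN
  unfold leafCount padCount arcTotal
  omega

/-- The list of the arcs of the digraph on the vertex numbers. -/
abbrev numberedArcs := (arcList L P x).map (Prod.map number number)

theorem map_numberedArcs :
    (numberedArcs (leafCount N d) P x).map (fun e => ((e.1 : ℕ), (e.2 : ℕ))) =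
      arcNumbers N d (entry x) := by
  simp only [numberedArcs, List.map_map, arcList, List.map_append, arcNumbers]
  congr 1
  · congr 1
    · congr 1
      · congr 1
        · refine map_pairList _ _ fun k => ?_
          simp [stepArc, number_chain]
          omega
        · refine map_pairList _ _ fun k => ?_
          simp [toHubArc, number_chain, number_hub]
      · refine map_pairList _ _ fun k => ?_
        simp only [toCoordArc, entry_eq, Function.comp_apply, Prod.map_apply, number_chain,
          number_coord, Fin.coe_divNat, Fin.coe_modNat]
        cases x k.divNat k.modNat <;> rfl
    · refine map_pairList _ _ fun k => ?_
      simp only [toTargetArc, entry_eq, Function.comp_apply, Prod.map_apply, number_target,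
        number_coord, Fin.coe_divNat, Fin.coe_modNat]
      cases x k.divNat k.modNat <;> rfl
  · refine map_pairList _ _ fun k => ?_
    have hL : 4 * (N + d) = leafCount N d := rfl
    simp [toLeafArc, hL, number_hub, number_leaf, Nat.div_add_mod]

theorem length_numberedArcs : (numberedArcs (leafCount N d) P x).length = arcTotal N d := by
  rw [← length_arcNumbers N d (entry x), ← map_numberedArcs P x]
  simp

end

/-! ### The reduction -/

open Vertex

/-- Build the digraph, run `p` on it in a separate part of the memory, and test the vector of the
source that `p` returns. -/
def reductionProg (p : Prog) : Prog := .seq buildProg (.seq p.shift checkProg)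

theorem agree_vectorInput {N d : ℕ} (x : Fin N → Fin d → Bool) :
    Agree (vectorInput x) (listState N d 0 (entry x) []) := by
  constructor
  · funext a i
    match a with
    | 0 => rfl
    | 1 | 2 | a + 3 => simp [vectorInput, listState, buildState, stateOf, arcMemory]
  · intro r _
    match r with
    | 0 | 1 | 2 | 3 | 4 | 5 | 6 | r + 7 => simp [vectorInput, listState, buildState, stateOf]

theorem hosts_graphInput {n N d k : ℕ} {X : ℕ → ℕ} {arcs : List (Fin n × Fin n)} {u : State}
    (hn : n = arcs.length)
    (hu : Agree u (stateOf N d k arcs.length 0 0 0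
      (Function.update (Function.update (fun _ => 0) 16 arcs.length) 17 arcs.length)
      (arcMemory X ((arcs.map fun e => ((e.1 : ℕ), (e.2 : ℕ))).map Prod.fst)
        ((arcs.map fun e => ((e.1 : ℕ), (e.2 : ℕ))).map Prod.snd)))) :
    Hosts u (graphInput n arcs) := by
  constructor
  · intro r
    rw [hu.reg _ (by omega)]
    match r with
    | 0 => exact hn.symm
    | 1 => rfl
    | r + 2 => simp [graphInput, stateOf, Function.update_apply]
  · intro a
    rw [hu.mem]
    funext i
    match a with
    | 0 | 1 =>
      by_cases h : i < arcs.length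
      · simp [graphInput, stateOf, arcMemory, h]
      · simp [graphInput, stateOf, arcMemory, h]
    | a + 2 => simp [graphInput, stateOf, arcMemory]

/-- If `p` finds a most central vertex within `T` steps on the digraphs with `arcTotal N d` vertices
and arcs and with diameter at most `9`, then `reductionProg p` finds out whether there are
orthogonal vectors among `N` vectors of length `d`. -/
theorem exists_run_reductionProg {N d : ℕ} (hN : 2 ≤ N) (x : Fin N → Fin d → Bool) {p : Prog}
    {κ : ℕ} {T : ℝ}
    (hp : ∀ (n : ℕ) (G : Digraph (Fin n)) (arcs : List (Fin n × Fin n)),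
      (∀ v, ¬ G.Adj v v) → ListsArcs G arcs → n = arcTotal N d → arcCount G = arcTotal N d →
      DiameterLE G 9 → ∃ (t : ℕ) (s : State),
        Run ((arcTotal N d + arcTotal N d) ^ κ) p (graphInput n arcs) t s ∧ (t : ℝ) ≤ T ∧
        ∃ v : Fin n, s.reg 0 = (v : ℕ) ∧ IsMostCentral G v) :
    ∃ (t : ℕ) (s : State), Run ((N + d) ^ (7 * κ + 10)) (reductionProg p) (vectorInput x) t s ∧
      (t : ℝ) ≤ 60 * (arcTotal N d + 6) + T + (40 * (N + 1) * (d + 1) + 30) ∧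
      (HasOrthogonalPair x → s.reg 0 = 1) ∧ (¬ HasOrthogonalPair x → s.reg 0 = 0) := by
  classical
  set W := N + d with hW
  have hW2 : 2 ≤ W := by omega
  have hNd : N * d ≤ W ^ 2 := by
    rw [sq]
    exact Nat.mul_le_mul (by omega) (by omega)
  have hWW : 2 * W ≤ W ^ 2 := by
    rw [sq]
    exact Nat.mul_le_mul_right W hW2
  have hpow (a b : ℕ) : 2 ^ a * W ^ b ≤ W ^ (a + b) := by
    rw [pow_add]
    exact Nat.mul_le_mul_right _ (Nat.pow_le_pow_left hW2 a)
  -- As `2 ≤ W`, constant factors are absorbed by powers of `W`.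
  have hB : 100 * (N + d + N * d) ≤ W ^ (7 * κ + 10) := by
    calc 100 * (N + d + N * d) ≤ 2 ^ 8 * W ^ 2 := by omega
      _ ≤ W ^ (8 + 2) := hpow 8 2
      _ ≤ W ^ (7 * κ + 10) := Nat.pow_le_pow_right (by omega) (by omega)
  have hB' : (arcTotal N d + arcTotal N d) ^ κ ≤ W ^ (7 * κ + 10) := by
    calc (arcTotal N d + arcTotal N d) ^ κ ≤ (W ^ 7) ^ κ := by
          refine Nat.pow_le_pow_left (le_trans ?_ (hpow 5 2)) κ
          unfold arcTotal
          omega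
      _ = W ^ (7 * κ) := (pow_mul W 7 κ).symm
      _ ≤ W ^ (7 * κ + 10) := Nat.pow_le_pow_right (by omega) (by omega)
  generalize W ^ (7 * κ + 10) = B at hB hB' ⊢
  set L := leafCount N d with hL
  set P := padCount N d with hP
  set G := vectorGraph L P x with hG
  set arcs := numberedArcs L P x with harcs
  have hlen : arcs.length = arcTotal N d := length_numberedArcs P x
  have hlists : ListsArcs (relabel number G) arcs := (listsArcs_arcList L P x).relabel number
  have hdiam : DiameterLE (relabel number G) 9 := by
    have hlevel : ∀ u v, (relabel number G).Adj u v →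
        level (number.symm v) = level (number.symm u) + 1 := fun u v h => level_of_adj x _ _ h
    intro u v h
    have h1 := h.level_eq_add_distance (level := fun v => level (number.symm v)) hlevel
    have h2 := level_le (number.symm v)
    omega
  have hloop : ∀ v, ¬ (relabel number G).Adj v v := fun v h => by
    have := level_of_adj x _ _ h
    omega
  obtain ⟨t₂, s₂, hrun, ht₂, v, hv, hmax⟩ := hp _ (relabel number G) arcs hloop hlists
    (vertexTotal_eq hN) (hlists.arcCount_eq.trans hlen) hdiam
  obtain ⟨v, rfl⟩ := (number (N := N) (d := d) (L := L) (P := P)).surjective v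
  have hmax' : IsMostCentral G v := fun w => by
    have := hmax (number w)
    rwa [closeness_relabel, closeness_relabel] at this
  obtain ⟨i, rfl, hi⟩ := exists_source_of_mostCentral x hN hmax'
  rw [number_chain] at hv
  obtain ⟨t₁, ht₁, u₁, hrun₁, hu₁⟩ :=
    spec_buildProg hN (entry_le_one x) hB (vectorInput x) (agree_vectorInput x)
  have hhost : Hosts u₁ (graphInput _ arcs) := by
    refine hosts_graphInput (k := 4 * (4 * (N + d))) (X := entry x) (N := N) (d := d)
      (hlen ▸ vertexTotal_eq hN) ?_
    rw [map_numberedArcs, hlen]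
    exact hu₁
  obtain ⟨u₂, hrun₂, hhost₂, hlow⟩ := (hrun.mono hB').shift u₁ hhost
  have hlow' (r : ℕ) (hr : r < 8) := (hlow.reg r (by omega)).trans (hu₁.reg r (.inl hr))
  obtain ⟨s₃, hspec, hs₃⟩ := spec_checkProg (N := N) (d := d) (r₂ := 4 * (4 * (N + d)))
    (r₃ := arcTotal N d) i.2 (entry_le_one x) hB (hireg := u₂.reg) (M := u₂.mem)
    (by rw [hlow.mem, hu₁.mem]; rfl) (by simpa using (hhost₂.reg 0).trans hv)
  obtain ⟨t₃, ht₃, u₃, hrun₃, hu₃⟩ := hspec u₂ ⟨rfl, fun r hr => by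
    match r with
    | 0 => exact hlow' 0 (by omega)
    | 1 => exact hlow' 1 (by omega)
    | 2 => exact hlow' 2 (by omega)
    | 3 => exact hlow' 3 (by omega)
    | 4 => exact hlow' 4 (by omega)
    | 5 => exact hlow' 5 (by omega)
    | 6 => exact hlow' 6 (by omega)
    | r + 7 => rfl⟩
  have hiff : HasOrthogonalPair x ↔ ∃ j < N, innerSum d (entry x) i j = 0 := by
    rw [hasOrthogonalPair_iff x hN hi]
    simp only [← innerSum_entry]
    exact ⟨fun ⟨j, hj⟩ => ⟨j, j.2, hj⟩, fun ⟨j, hj, h⟩ => ⟨⟨j, hj⟩, h⟩⟩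
  refine ⟨t₁ + (t₂ + t₃), u₃, hrun₁.seq (hrun₂.seq hrun₃), ?_, ?_⟩
  · have h1 : (t₁ : ℝ) ≤ 60 * (arcTotal N d + 6) := by exact_mod_cast ht₁
    have h3 : (t₃ : ℝ) ≤ 40 * (N + 1) * (d + 1) + 30 := by exact_mod_cast ht₃
    push_cast
    linarith
  · rw [hu₃.reg 0 (by omega), hs₃, hiff]
    exact ⟨fun h => if_pos h, fun h => if_neg h⟩

/-! ### The running time -/

/-- For `d = O(log ^ k N)`, the factor `(d + 1) ^ 2` is at most an arbitrarily small power of `N`. -/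
theorem polylog_sq_le (k c : ℕ) {δ : ℝ} (hδ : 0 < δ) : ∃ D : ℝ, ∀ N d : ℕ, 2 ≤ N →
    d ≤ c * Nat.log 2 N ^ k → ((d : ℝ) + 1) ^ 2 ≤ D * (N : ℝ) ^ δ := by
  -- With this exponent, `(N ^ η) ^ k ≤ N ^ (δ / 2)`, and squaring gives `N ^ δ`.
  set η := δ / (2 * (k + 1)) with hη
  have hη0 : 0 < η := by positivity
  set A := 1 / (η * Real.log 2) with hA
  have hlog2 : 0 < Real.log 2 := Real.log_pos one_lt_two
  have hA0 : 0 ≤ A := by positivity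
  refine ⟨(c * A ^ k + 1) ^ 2, fun N d hN hd => ?_⟩
  have hN0 : (0 : ℝ) ≤ N := Nat.cast_nonneg N
  have hN1 : (1 : ℝ) ≤ N := by exact_mod_cast (by omega : 1 ≤ N)
  have h1 : (Nat.log 2 N : ℝ) ≤ A * (N : ℝ) ^ η := by
    calc (Nat.log 2 N : ℝ) ≤ Real.logb 2 N := by exact_mod_cast Real.natLog_le_logb N 2
      _ = Real.log N / Real.log 2 := rfl
      _ ≤ ((N : ℝ) ^ η / η) / Real.log 2 := by gcongr; exact Real.log_le_rpow_div hN0 hη0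
      _ = A * (N : ℝ) ^ η := by rw [hA]; field_simp
  have h2 : ((N : ℝ) ^ η) ^ k ≤ (N : ℝ) ^ (δ / 2) := by
    rw [← Real.rpow_natCast, ← Real.rpow_mul hN0]
    refine Real.rpow_le_rpow_of_exponent_le hN1 ?_
    rw [hη, div_mul_eq_mul_div, div_le_div_iff₀ (by positivity) two_pos]
    nlinarith
  have h3 : (d : ℝ) ≤ c * A ^ k * (N : ℝ) ^ (δ / 2) := by
    calc (d : ℝ) ≤ c * (Nat.log 2 N : ℝ) ^ k := by exact_mod_cast hd
      _ ≤ c * (A * (N : ℝ) ^ η) ^ k := by gcongr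
      _ = c * A ^ k * ((N : ℝ) ^ η) ^ k := by rw [mul_pow, mul_assoc]
      _ ≤ c * A ^ k * (N : ℝ) ^ (δ / 2) := by gcongr
  have h4 : (1 : ℝ) ≤ (N : ℝ) ^ (δ / 2) := Real.one_le_rpow hN1 (by positivity)
  calc ((d : ℝ) + 1) ^ 2 ≤ ((c * A ^ k + 1) * (N : ℝ) ^ (δ / 2)) ^ 2 := by
        gcongr
        linarith
    _ = (c * A ^ k + 1) ^ 2 * (N : ℝ) ^ δ := by
        rw [mul_pow, ← Real.rpow_natCast ((N : ℝ) ^ (δ / 2)), ← Real.rpow_mul hN0]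
        norm_num

theorem total_time_le {N d : ℕ} (hN : 2 ≤ N) {ε δ C D : ℝ} (hδ0 : 0 < δ) (hδ1 : δ ≤ 1)
    (hδ : δ ≤ ε) (hD : ((d : ℝ) + 1) ^ 2 ≤ D * (N : ℝ) ^ (δ / 2)) :
    60 * ((arcTotal N d : ℝ) + 6) + C * (arcTotal N d : ℝ) ^ (2 - ε) +
      (40 * (N + 1) * (d + 1) + 30) ≤ (2700 + 1600 * |C|) * D * (N : ℝ) ^ (2 - δ / 2) := by
  have hN2 : (2 : ℝ) ≤ N := by exact_mod_cast hN
  have hd0 : (0 : ℝ) ≤ d := Nat.cast_nonneg d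
  have hNd : (2 : ℝ) * d ≤ N * d := mul_le_mul_of_nonneg_right hN2 hd0
  set Q : ℝ := N * (d + 1) with hQ
  have hQ' : Q = N * d + N := by rw [hQ]; ring
  have hQ1 : 1 ≤ Q := by linarith
  set A : ℝ := (arcTotal N d : ℝ) with hA
  have hA' : A = 23 * N + 2 * (N * d) + 16 * d := by
    rw [hA, arcTotal]
    push_cast
    ring
  have hA1 : 1 ≤ A := by linarith
  have hAQ : A ≤ 40 * Q := by linarith
  have h1 : A ^ (2 - ε) ≤ 1600 * Q ^ (2 - δ) := by
    calc A ^ (2 - ε) ≤ A ^ (2 - δ) := Real.rpow_le_rpow_of_exponent_le hA1 (by linarith)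
      _ ≤ (40 * Q) ^ (2 - δ) := Real.rpow_le_rpow (by linarith) hAQ (by linarith)
      _ = 40 ^ (2 - δ) * Q ^ (2 - δ) := Real.mul_rpow (by norm_num) (by linarith)
      _ ≤ 40 ^ (2 : ℝ) * Q ^ (2 - δ) := by
        gcongr
        · norm_num
        · linarith
      _ = 1600 * Q ^ (2 - δ) := by norm_num
  have h2 : Q ≤ Q ^ (2 - δ) := by
    calc Q = Q ^ (1 : ℝ) := (Real.rpow_one Q).symm
      _ ≤ Q ^ (2 - δ) := Real.rpow_le_rpow_of_exponent_le hQ1 (by linarith)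
  have h3 : Q ^ (2 - δ) ≤ D * (N : ℝ) ^ (2 - δ / 2) := by
    calc Q ^ (2 - δ) = (N : ℝ) ^ (2 - δ) * ((d : ℝ) + 1) ^ (2 - δ) :=
          Real.mul_rpow (by linarith) (by linarith)
      _ ≤ (N : ℝ) ^ (2 - δ) * ((d : ℝ) + 1) ^ (2 : ℝ) := by
        gcongr
        · linarith
        · linarith
      _ = (N : ℝ) ^ (2 - δ) * ((d : ℝ) + 1) ^ 2 := by norm_num
      _ ≤ (N : ℝ) ^ (2 - δ) * (D * (N : ℝ) ^ (δ / 2)) := by gcongr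
      _ = D * (N : ℝ) ^ (2 - δ / 2) := by
        rw [mul_left_comm, ← Real.rpow_add (by linarith)]
        ring_nf
  have h4 : C * A ^ (2 - ε) ≤ |C| * (1600 * Q ^ (2 - δ)) :=
    mul_le_mul (le_abs_self C) h1 (by positivity) (abs_nonneg C)
  have h5 : (40 : ℝ) * (N + 1) * (d + 1) ≤ 80 * Q := by nlinarith
  calc _ ≤ 2700 * Q ^ (2 - δ) + |C| * (1600 * Q ^ (2 - δ)) := by linarith
    _ = (2700 + 1600 * |C|) * Q ^ (2 - δ) := by ring
    _ ≤ (2700 + 1600 * |C|) * (D * (N : ℝ) ^ (2 - δ / 2)) := by gcongr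
    _ = _ := by ring

theorem MostCentralSolvable.mono {𝒢 𝒢' : (n : ℕ) → Digraph (Fin n) → Prop}
    (h : ∀ n G, 𝒢' n G → 𝒢 n G) {ε : ℝ} (hs : MostCentralSolvable 𝒢 ε) :
    MostCentralSolvable 𝒢' ε :=
  let ⟨p, κ, C, hp⟩ := hs
  ⟨p, κ, C, fun n G arcs h1 h2 h3 h4 => hp n G arcs h1 h2 h3 (h n G h4)⟩

/-- Digraphs with as many vertices as arcs and with diameter at most `9` are hard already. -/
theorem not_orthogonalVectorConjecture {ε : ℝ} (hε : 0 < ε)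
    (h : MostCentralSolvable (fun n G => n = arcCount G ∧ DiameterLE G 9) ε) :
    ¬ OrthogonalVectorConjecture := by
  obtain ⟨p, κ, C, hp⟩ := h
  intro hOV
  have hδ0 : 0 < min ε 1 := lt_min hε one_pos
  obtain ⟨k, c, hkc⟩ := hOV (min ε 1 / 2) (half_pos hδ0)
  obtain ⟨D, hD⟩ := polylog_sq_le k c (half_pos hδ0)
  refine hkc ⟨reductionProg p, 7 * κ + 10, (2700 + 1600 * |C|) * D, fun N d x hN hd => ?_⟩
  obtain ⟨t, s, hrun, ht, hs⟩ := exists_run_reductionProg hN x (p := p) (κ := κ)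
    (T := C * (arcTotal N d : ℝ) ^ (2 - ε)) (by
      intro n G arcs h1 h2 hn hm h3
      have h4 : 1 ≤ arcCount G := by
        rw [hm, arcTotal]
        omega
      obtain ⟨t, s, hrun, ht, hv⟩ := hp n G arcs h1 h2 h4 ⟨hn.trans hm.symm, h3⟩
      rw [hm] at hrun ht
      subst hn
      exact ⟨t, s, hrun, ht, hv⟩)
  exact ⟨t, s, hrun, ht.trans (total_time_le hN hδ0 (min_le_right ε 1) (min_le_left ε 1)
    (hD N d hN hd)), hs⟩

end ClosenessHardness

theorem theorem1 :
    -- all digraphs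
    ((∃ ε : ℝ, 0 < ε ∧ ClosenessHardness.MostCentralSolvable (fun _ _ => True) ε) →
      ¬ ClosenessHardness.OrthogonalVectorConjecture) ∧
    -- sparse digraphs
    (∀ K : ℕ, 1 ≤ K →
      (∃ ε : ℝ, 0 < ε ∧ ClosenessHardness.MostCentralSolvable
        (fun n G => ClosenessHardness.arcCount G ≤ K * n ∧
          n ≤ K * ClosenessHardness.arcCount G) ε) →
      ¬ ClosenessHardness.OrthogonalVectorConjecture) ∧
    -- sparse digraphs of diameter at most 9
    (∀ K : ℕ, 1 ≤ K →
      (∃ ε : ℝ, 0 < ε ∧ ClosenessHardness.MostCentralSolvable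
        (fun n G => ClosenessHardness.arcCount G ≤ K * n ∧
          n ≤ K * ClosenessHardness.arcCount G ∧ ClosenessHardness.DiameterLE G 9) ε) →
      ¬ ClosenessHardness.OrthogonalVectorConjecture) := by
  refine ⟨fun ⟨ε, hε, h⟩ => ?_, fun K hK ⟨ε, hε, h⟩ => ?_, fun K hK ⟨ε, hε, h⟩ => ?_⟩
  all_goals
    refine ClosenessHardness.not_orthogonalVectorConjecture hε (h.mono fun n G hG => ?_)
  · trivial
  · rw [← hG.1]
    exact ⟨Nat.le_mul_of_pos_left n hK, Nat.le_mul_of_pos_left n hK⟩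
  · rw [← hG.1]
    exact ⟨Nat.le_mul_of_pos_left n hK, Nat.le_mul_of_pos_left n hK, hG.2⟩
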